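/- There is a real number $\varepsilon>0$ such that every finite simple planar graph $G$ that does not contain the diamond $K_4^-$ (the complete graph $K_4$ with one edge removed) as a (not necessarily induced) subgraph is weighted $\varepsilon$-flexible for lists of size $5$. That is, for every assignment $L$ of a set $L(v)$ of exactly $5$ colors to each vertex $v$ of $G$, and every function $w$ assigning a nonnegative real number $w(v,c)$ to each pair $(v,c)$ with $v\in V(G)$ and $c\in L(v)$, there is a proper coloring $\varphi$ of $G$ with $\varphi(v)\in L(v)$ for all $v\in V(G)$ and $$\sum_{v\in V(G)} w(v,\varphi(v))\;\ge\;\varepsilon\sum_{v\in V(G)}\sum_{c\in L(v)} w(v,c).$$ -/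

import Mathlib

universe u v

/-- `IsPolygonalArc A a b`: the set `A` is a simple polygonal arc in the plane with end points `a`
and `b`. It is the union of the `n ≥ 1` segments `[p i, p (i+1)]`, `i < n`, all nondegenerate, where
consecutive segments share only their common end point, and all other pairs are disjoint. -/
def IsPolygonalArc (A : Set (ℝ × ℝ)) (a b : ℝ × ℝ) : Prop :=
  ∃ (n : ℕ) (p : ℕ → ℝ × ℝ), 0 < n ∧ p 0 = a ∧ p n = b ∧
    A = {x | ∃ i < n, x ∈ segment ℝ (p i) (p (i + 1))} ∧
    (∀ i < n, p i ≠ p (i + 1)) ∧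
    (∀ i, i + 1 < n →
      segment ℝ (p i) (p (i + 1)) ∩ segment ℝ (p (i + 1)) (p (i + 2)) = {p (i + 1)}) ∧
    (∀ i j, i + 1 < j → j < n →
      Disjoint (segment ℝ (p i) (p (i + 1))) (segment ℝ (p j) (p (j + 1))))

/-- A plane embedding of a graph: vertices are distinct points of the plane, every edge is a simple
(polygonal) arc joining its two ends, an edge contains no vertex other than its ends,
and two different edges meet at most in common end vertices. The values of `arc` at pairs that are
not edges are irrelevant. -/
structure PlaneEmbedding {V : Type*} (G : SimpleGraph V) where
  pos : V → ℝ × ℝ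
  arc : Sym2 V → Set (ℝ × ℝ)
  pos_injective : Function.Injective pos
  isPolygonalArc : ∀ u v, G.Adj u v → IsPolygonalArc (arc s(u, v)) (pos u) (pos v)
  mem_of_pos_mem : ∀ e ∈ G.edgeSet, ∀ v, pos v ∈ arc e → v ∈ e
  arc_inter : ∀ e ∈ G.edgeSet, ∀ f ∈ G.edgeSet, e ≠ f →
    ∀ x, x ∈ arc e → x ∈ arc f → ∃ v, v ∈ e ∧ v ∈ f ∧ x = pos v

/-- A graph is planar if it has an embedding in the plane. -/
def IsPlanar {V : Type*} (G : SimpleGraph V) : Prop :=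
  Nonempty (PlaneEmbedding G)

/-- The diamond `K₄⁻`: the complete graph on four vertices with one edge removed. -/
def diamondGraph : SimpleGraph (Fin 4) :=
  (⊤ : SimpleGraph (Fin 4)).deleteEdges {s(0, 1)}

/-- `φ` is an `L`-coloring: a proper coloring that takes the color of each vertex from its list. -/
def IsListColoring {V C : Type*} {G : SimpleGraph V} (L : V → Finset C) (φ : G.Coloring C) :
    Prop :=
  ∀ v, φ v ∈ L v

/-- A weighted request assigns a nonnegative real to each pair `(v, c)` with `c ∈ L v`
(values at other pairs are irrelevant). -/
def IsWeightedRequest {V C : Type*} (L : V → Finset C) (w : V → C → ℝ) : Prop :=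
  ∀ v, ∀ c ∈ L v, 0 ≤ w v c

/-- The request `w` is `ε`-satisfiable: some `L`-coloring of `G` collects at least the fraction `ε`
of the total weight `w(G, L)`. -/
def IsSatisfiable {V C : Type*} [Fintype V] (G : SimpleGraph V) (L : V → Finset C)
    (w : V → C → ℝ) (ε : ℝ) : Prop :=
  ∃ φ : G.Coloring C, IsListColoring L φ ∧
    ε * ∑ v, ∑ c ∈ L v, w v c ≤ ∑ v, w v (φ v)

/-- `G` with the list assignment `L` is weighted `ε`-flexible. -/
def IsWeightedFlexible {V C : Type*} [Fintype V] (G : SimpleGraph V) (L : V → Finset C)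
    (ε : ℝ) : Prop :=
  ∀ w : V → C → ℝ, IsWeightedRequest L w → IsSatisfiable G L w ε

/-- `G` is weighted `ε`-flexible for lists of size `k`. -/
def IsWeightedFlexibleForListsOfSize {V : Type u} [Fintype V] (G : SimpleGraph V)
    (ε : ℝ) (k : ℕ) : Prop :=
  ∀ (C : Type v) (L : V → Finset C), (∀ x, (L x).card = k) → IsWeightedFlexible G L ε

/-!
The proof has three ingredients.

*Random colorings.* It suffices to find a random list coloring in which each vertex receives each
color of its list with probability at least a fixed `ε`, since the expected weight is then at least
the fraction `ε` of the total. Such a random coloring is built by induction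
(`exists_isColoringDistribution`): remove a *reducible* set `H` of at most five vertices
(`IsReducible`), and extend a random coloring of the rest uniformly to `H`. For a vertex `v` of `H`
to receive the color `c`, the at most three neighbors of `v` outside `H` must avoid `c`. The
induction therefore also bounds from below the probability that a random coloring avoids a color on
at most three common neighbors of a vertex already removed. The sets `H` used are single vertices or
unions of triangles, so in a diamond-free graph the neighbors in `H` of a removed vertex are
independent, and only independent subsets of `H` have to be treated.

*Discharging.* A nonempty plane graph with `n` vertices, `e` edges and `t` triangles satisfies
`2 * e + 4 ≤ 4 * n + t`, that is, the sum of `deg v - 4` is less than `t`. In a diamond-free graph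
the triangles are edge-disjoint, and discharging yields a vertex of degree at most 3, a triangle
with degrees at most 5, 4, 4, or a vertex of degree at most 6 in two triangles whose other vertices
have degree at most 4
(`SimpleGraph.exists_light_configuration`). Each of these is reducible.

*Faces.* The inequality `2 * e + 4 ≤ 4 * n + t` replaces Euler's formula. It holds because the cycle
space over `𝔽₂`, of dimension at least `e - n + 1`, is spanned by elements that cover each edge at
most twice, while a nonzero element with fewer than four edges is a triangle
(`PlaneEmbedding.two_mul_card_edgeSet_le`). The spanning elements are the face boundaries, which are
obtained without the Jordan curve theorem (`IsSegmentSystem.exists_isTwoSpanning`): cut the edges at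
their bends, shear the plane so that all points have distinct abscissas, and define the face on a
side of a segment as the functional that sends an element `z` of the cycle space to the parity of
the number of segments of `z` below that side. This parity is constant along a segment, because
`z` has even degree at the points below it; around a point the parities telescope, which shows that
face boundaries have even degree. Finally, `z` is the sum of the boundaries of the faces where its
parity is odd.
-/

open Finset

/-! ### The cycle space of a finite multigraph over the field with two elements -/

/-- The cycle space over `𝔽₂` of the multigraph with edge set `S` whose edge `s` joins the points
`a s` and `b s`: the sets of edges, as indicator functions, that have even degree at each point. -/
def cycleSpace {S P : Type*} [Fintype S] [DecidableEq P] (a b : S → P) :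
    Submodule (ZMod 2) (S → ZMod 2) where
  carrier := {z | ∀ p, ∑ s, ((if a s = p then z s else 0) + (if b s = p then z s else 0)) = 0}
  add_mem' := by
    intro y z hy hz p
    have := congrArg₂ (· + ·) (hy p) (hz p)
    simp only [← sum_add_distrib, add_zero] at this
    refine Eq.trans (sum_congr rfl fun s _ => ?_) this
    simp only [Pi.add_apply]
    split_ifs <;> ring
  zero_mem' := by intro p; simp
  smul_mem' := by
    intro c z hz p
    have := congrArg (c * ·) (hz p)
    simp only [mul_sum, mul_zero] at this
    refine Eq.trans (sum_congr rfl fun s _ => ?_) this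
    simp only [Pi.smul_apply, smul_eq_mul]
    split_ifs <;> ring

theorem mem_cycleSpace {S P : Type*} [Fintype S] [DecidableEq P] {a b : S → P}
    {z : S → ZMod 2} : z ∈ cycleSpace a b ↔
      ∀ p, ∑ s, ((if a s = p then z s else 0) + (if b s = p then z s else 0)) = 0 :=
  Iff.rfl

/-- A set `T` of elements of the cycle space that spans it, such that each edge lies in at most two
members of `T`. -/
structure IsTwoSpanning {S P : Type*} [Fintype S] [DecidableEq P] (a b : S → P)
    (T : Finset (S → ZMod 2)) : Prop where
  mem : ∀ z ∈ T, z ∈ cycleSpace a b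
  le_span : cycleSpace a b ≤ Submodule.span (ZMod 2) (T : Set (S → ZMod 2))
  card_le : ∀ s, #{z ∈ T | z s ≠ 0} ≤ 2

/-! ### Noncrossing segments -/

/-- Finitely many non-vertical segments in the plane, the segment `s` having left end `a s` and
right end `b s`, which meet only in common ends; distinct ends have distinct abscissas. -/
structure IsSegmentSystem {S : Type*} (a b : S → ℝ × ℝ) : Prop where
  lt : ∀ s, (a s).1 < (b s).1
  inter : ∀ s t, s ≠ t → ∀ x, x ∈ segment ℝ (a s) (b s) → x ∈ segment ℝ (a t) (b t) →
    x = a s ∨ x = b s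
  inj_left : ∀ s t, (a s).1 = (a t).1 → a s = a t
  inj_right : ∀ s t, (b s).1 = (b t).1 → b s = b t
  inj_left_right : ∀ s t, (a s).1 = (b t).1 → a s = b t

/-- The slope of the line through two points with distinct abscissas. -/
noncomputable def planeSlope (p q : ℝ × ℝ) : ℝ := (q.2 - p.2) / (q.1 - p.1)

/-- The ordinate at `x` of the line through `p` and `q`. -/
noncomputable def lineHeight (p q : ℝ × ℝ) (x : ℝ) : ℝ := p.2 + (x - p.1) * planeSlope p q

theorem lineHeight_left (p q : ℝ × ℝ) : lineHeight p q p.1 = p.2 := by simp [lineHeight]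

theorem lineHeight_eq_right {p q : ℝ × ℝ} (h : p.1 < q.1) (x : ℝ) :
    lineHeight p q x = q.2 + (x - q.1) * planeSlope p q := by
  have : q.1 - p.1 ≠ 0 := by linarith
  simp only [lineHeight, planeSlope]
  field_simp
  ring

theorem lineHeight_right {p q : ℝ × ℝ} (h : p.1 < q.1) : lineHeight p q q.1 = q.2 := by
  simp [lineHeight_eq_right h]

theorem continuous_lineHeight (p q : ℝ × ℝ) : Continuous (lineHeight p q) := by
  unfold lineHeight; fun_prop

theorem mk_lineHeight_mem_segment {p q : ℝ × ℝ} (h : p.1 < q.1) {x : ℝ} (h1 : p.1 ≤ x)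
    (h2 : x ≤ q.1) : (x, lineHeight p q x) ∈ segment ℝ p q := by
  have h0 : 0 < q.1 - p.1 := by linarith
  rw [segment_eq_image]
  refine ⟨(x - p.1) / (q.1 - p.1), ⟨by apply div_nonneg <;> linarith,
    by rw [div_le_one h0]; linarith⟩, ?_⟩
  ext
  · simp; field_simp; ring
  · simp [lineHeight, planeSlope]; field_simp; ring

theorem exists_mem_uIcc_lineHeight_eq {p q p' q' : ℝ × ℝ} {x y : ℝ}
    (hx : lineHeight p q x < lineHeight p' q' x) (hy : ¬ lineHeight p q y < lineHeight p' q' y) :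
    ∃ t ∈ Set.uIcc x y, t ≠ x ∧ lineHeight p q t = lineHeight p' q' t := by
  have hc : ContinuousOn (fun t => lineHeight p' q' t - lineHeight p q t) (Set.uIcc x y) :=
    ((continuous_lineHeight _ _).sub (continuous_lineHeight _ _)).continuousOn
  have h0 : (0 : ℝ) ∈ Set.uIcc (lineHeight p' q' x - lineHeight p q x)
      (lineHeight p' q' y - lineHeight p q y) := by
    rw [Set.mem_uIcc]; right; constructor <;> linarith
  obtain ⟨t, ht, h⟩ := intermediate_value_uIcc hc h0
  refine ⟨t, ht, ?_, by simp only at h; linarith⟩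
  rintro rfl
  simp only at h; linarith

section SegmentSystem

variable {S : Type*} {a b : S → ℝ × ℝ}

/-- Somewhere strictly between the ends of both segments, `f` runs below `s`. In a segment system
this is then the case throughout the open interval over which both run. -/
def IsBelow (a b : S → ℝ × ℝ) (f s : S) : Prop :=
  ∃ x, ((a f).1 < x ∧ x < (b f).1) ∧ ((a s).1 < x ∧ x < (b s).1) ∧
    lineHeight (a f) (b f) x < lineHeight (a s) (b s) x

/-- The point `p` lies below the relative interior of the segment `s`. -/
def IsPointBelow (a b : S → ℝ × ℝ) (p : ℝ × ℝ) (s : S) : Prop :=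
  ((a s).1 < p.1 ∧ p.1 < (b s).1) ∧ p.2 < lineHeight (a s) (b s) p.1

/-- The relative interior of the segment `f` passes below the point `p`. -/
def PassesBelow (a b : S → ℝ × ℝ) (f : S) (p : ℝ × ℝ) : Prop :=
  ((a f).1 < p.1 ∧ p.1 < (b f).1) ∧ lineHeight (a f) (b f) p.1 < p.2

theorem not_isBelow_self (s : S) : ¬ IsBelow a b s s := fun ⟨_, _, _, h⟩ => lt_irrefl _ h

namespace IsSegmentSystem

variable (h : IsSegmentSystem a b)
include h

theorem eq_end_of_lineHeight_eq {f s : S} (hfs : f ≠ s) {x : ℝ} (hf : (a f).1 ≤ x ∧ x ≤ (b f).1)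
    (hs : (a s).1 ≤ x ∧ x ≤ (b s).1)
    (he : lineHeight (a f) (b f) x = lineHeight (a s) (b s) x) :
    ((x = (a f).1 ∨ x = (b f).1) ∧ (x = (a s).1 ∨ x = (b s).1)) := by
  have h1 := mk_lineHeight_mem_segment (h.lt f) hf.1 hf.2
  have h2 := mk_lineHeight_mem_segment (h.lt s) hs.1 hs.2
  rw [← he] at h2
  have k1 := h.inter f s hfs _ h1 h2
  have k2 := h.inter s f hfs.symm _ h2 h1
  constructor
  · rcases k1 with k | k
    · left; rw [← k]
    · right; rw [← k]
  · rcases k2 with k | k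
    · left; rw [← k]
    · right; rw [← k]

/-- If `f` runs below `s` at one abscissa, then at each other common abscissa that is interior to
one of the two segments, because a crossing in between would be a common end. -/
theorem lineHeight_lt_of_lt {f s : S} (hfs : f ≠ s) {x y : ℝ}
    (hfx : (a f).1 ≤ x ∧ x ≤ (b f).1) (hsx : (a s).1 ≤ x ∧ x ≤ (b s).1)
    (hfy : (a f).1 ≤ y ∧ y ≤ (b f).1) (hsy : (a s).1 ≤ y ∧ y ≤ (b s).1)
    (hy : ((a f).1 < y ∧ y < (b f).1) ∨ ((a s).1 < y ∧ y < (b s).1))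
    (hlt : lineHeight (a f) (b f) x < lineHeight (a s) (b s) x) :
    lineHeight (a f) (b f) y < lineHeight (a s) (b s) y := by
  by_contra hn
  obtain ⟨t, ht, htx, he⟩ := exists_mem_uIcc_lineHeight_eq hlt hn
  rw [Set.mem_uIcc] at ht
  have hft : (a f).1 ≤ t ∧ t ≤ (b f).1 := by
    rcases ht with ht | ht <;> constructor <;> linarith [hfx.1, hfx.2, hfy.1, hfy.2, ht.1, ht.2]
  have hst : (a s).1 ≤ t ∧ t ≤ (b s).1 := by
    rcases ht with ht | ht <;> constructor <;> linarith [hsx.1, hsx.2, hsy.1, hsy.2, ht.1, ht.2]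
  have hty : (t = y) ∨ ((a f).1 < t ∧ t < (b f).1 ∨ ((a s).1 < t ∧ t < (b s).1)) := by
    by_cases hty : t = y
    · exact Or.inl hty
    · right; left
      rcases ht with ht | ht
      · have := lt_of_le_of_ne ht.1 (Ne.symm htx)
        have := lt_of_le_of_ne ht.2 hty
        constructor <;> linarith [hfx.1, hfy.2]
      · have := lt_of_le_of_ne ht.2 htx
        have := lt_of_le_of_ne ht.1 (Ne.symm hty)
        constructor <;> linarith [hfx.2, hfy.1]
  have hin : (a f).1 < t ∧ t < (b f).1 ∨ ((a s).1 < t ∧ t < (b s).1) := by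
    rcases hty with rfl | h'
    · exact hy
    · exact h'
  obtain ⟨k1, k2⟩ := h.eq_end_of_lineHeight_eq hfs hft hst he
  rcases hin with ⟨i1, i2⟩ | ⟨i1, i2⟩
  · rcases k1 with k | k <;> linarith
  · rcases k2 with k | k <;> linarith

theorem isBelow_of_lineHeight_lt {f s : S} (hfs : f ≠ s) {x : ℝ}
    (hf : (a f).1 ≤ x ∧ x ≤ (b f).1) (hs : (a s).1 ≤ x ∧ x ≤ (b s).1)
    (hx : ((a f).1 < x ∧ x < (b f).1) ∨ ((a s).1 < x ∧ x < (b s).1))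
    (hlt : lineHeight (a f) (b f) x < lineHeight (a s) (b s) x) : IsBelow a b f s := by
  have hf' := h.lt f
  have hs' := h.lt s
  have : max (a f).1 (a s).1 < min (b f).1 (b s).1 := by
    rw [max_lt_iff, lt_min_iff, lt_min_iff]
    rcases hx with ⟨i, j⟩ | ⟨i, j⟩ <;>
      exact ⟨⟨by linarith [hf.1, hf.2, hs.1, hs.2], by linarith [hf.1, hf.2, hs.1, hs.2]⟩,
        ⟨by linarith [hf.1, hf.2, hs.1, hs.2], by linarith [hf.1, hf.2, hs.1, hs.2]⟩⟩
  obtain ⟨y, hy1, hy2⟩ := exists_between this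
  rw [max_lt_iff] at hy1
  rw [lt_min_iff] at hy2
  exact ⟨y, ⟨hy1.1, hy2.1⟩, ⟨hy1.2, hy2.2⟩, h.lineHeight_lt_of_lt hfs hf hs
    ⟨hy1.1.le, hy2.1.le⟩ ⟨hy1.2.le, hy2.2.le⟩ (Or.inl ⟨hy1.1, hy2.1⟩) hlt⟩

theorem isPointBelow_left_iff {f s : S} (hfs : f ≠ s) :
    IsPointBelow a b (a f) s ↔ IsBelow a b f s ∧ (a s).1 < (a f).1 := by
  have hf := h.lt f
  constructor
  · rintro ⟨h1, h2⟩
    rw [← lineHeight_left (a f) (b f)] at h2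
    exact ⟨h.isBelow_of_lineHeight_lt hfs ⟨le_rfl, hf.le⟩ ⟨h1.1.le, h1.2.le⟩ (Or.inr h1) h2, h1.1⟩
  · rintro ⟨⟨x, hx, hx', hlt⟩, h1⟩
    have h2 : (a f).1 < (b s).1 := by linarith
    refine ⟨⟨h1, h2⟩, ?_⟩
    have := h.lineHeight_lt_of_lt hfs (y := (a f).1) ⟨hx.1.le, hx.2.le⟩ ⟨hx'.1.le, hx'.2.le⟩
      ⟨le_rfl, hf.le⟩ ⟨h1.le, h2.le⟩ (Or.inr ⟨h1, h2⟩) hlt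
    rwa [lineHeight_left] at this

theorem isPointBelow_right_iff {f s : S} (hfs : f ≠ s) :
    IsPointBelow a b (b f) s ↔ IsBelow a b f s ∧ (b f).1 < (b s).1 := by
  have hf := h.lt f
  constructor
  · rintro ⟨h1, h2⟩
    rw [← lineHeight_right hf] at h2
    exact ⟨h.isBelow_of_lineHeight_lt hfs ⟨hf.le, le_rfl⟩ ⟨h1.1.le, h1.2.le⟩ (Or.inr h1) h2, h1.2⟩
  · rintro ⟨⟨x, hx, hx', hlt⟩, h1⟩
    have h2 : (a s).1 < (b f).1 := by linarith
    refine ⟨⟨h2, h1⟩, ?_⟩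
    have := h.lineHeight_lt_of_lt hfs (y := (b f).1) ⟨hx.1.le, hx.2.le⟩ ⟨hx'.1.le, hx'.2.le⟩
      ⟨hf.le, le_rfl⟩ ⟨h2.le, h1.le⟩ (Or.inr ⟨h2, h1⟩) hlt
    rwa [lineHeight_right hf] at this

/-- The segments that run below `s` near the left end of `s`. -/
theorem isBelow_and_left_le_iff {f s : S} :
    IsBelow a b f s ∧ (a f).1 ≤ (a s).1 ↔ PassesBelow a b f (a s) ∨
      (a f = a s ∧ planeSlope (a f) (b f) < planeSlope (a s) (b s)) := by
  by_cases hfs : f = s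
  · subst hfs
    simp [not_isBelow_self, PassesBelow]
  have hf := h.lt f
  have hs := h.lt s
  by_cases hl : a f = a s
  · have h1 : ¬ PassesBelow a b f (a s) := fun h' => by
      have := h'.1.1; rw [hl] at this; exact lt_irrefl _ this
    have key : ∀ x, (a s).1 < x → (lineHeight (a f) (b f) x < lineHeight (a s) (b s) x ↔
        planeSlope (a f) (b f) < planeSlope (a s) (b s)) := by
      intro x hx
      rw [lineHeight, lineHeight, hl, add_lt_add_iff_left, mul_lt_mul_iff_right₀ (by linarith)]
    simp only [h1, false_or, hl, true_and, le_refl, and_true]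
    rw [← hl]
    constructor
    · rintro ⟨x, hx, hx', hlt⟩
      have := (key x hx'.1).1 hlt
      rwa [← hl] at this
    · intro hlt
      obtain ⟨x, hx1, hx2⟩ := exists_between (show (a s).1 < min (b f).1 (b s).1 by
        rw [lt_min_iff]; exact ⟨by rw [← hl]; exact hf, hs⟩)
      rw [lt_min_iff] at hx2
      exact ⟨x, ⟨by rw [hl]; exact hx1, hx2.1⟩, ⟨hx1, hx2.2⟩, (key x hx1).2 (by rwa [← hl])⟩
  · simp only [hl, false_and, or_false]
    constructor
    · rintro ⟨⟨x, hx, hx', hlt⟩, hle⟩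
      have h1 : (a f).1 < (a s).1 := lt_of_le_of_ne hle fun he => hl (h.inj_left _ _ he)
      have h2 : (a s).1 < (b f).1 := by linarith
      refine ⟨⟨h1, h2⟩, ?_⟩
      have := h.lineHeight_lt_of_lt hfs (y := (a s).1) ⟨hx.1.le, hx.2.le⟩ ⟨hx'.1.le, hx'.2.le⟩
        ⟨h1.le, h2.le⟩ ⟨le_rfl, hs.le⟩ (Or.inl ⟨h1, h2⟩) hlt
      rwa [lineHeight_left (a s)] at this
    · rintro ⟨h1, h2⟩
      refine ⟨h.isBelow_of_lineHeight_lt hfs ⟨h1.1.le, h1.2.le⟩ ⟨le_rfl, hs.le⟩ (Or.inl h1) ?_,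
        h1.1.le⟩
      rwa [lineHeight_left (a s)]

/-- The segments that run below `s` near the right end of `s`. -/
theorem isBelow_and_le_right_iff {f s : S} :
    IsBelow a b f s ∧ (b s).1 ≤ (b f).1 ↔ PassesBelow a b f (b s) ∨
      (b f = b s ∧ -planeSlope (a f) (b f) < -planeSlope (a s) (b s)) := by
  by_cases hfs : f = s
  · subst hfs
    simp [not_isBelow_self, PassesBelow]
  have hf := h.lt f
  have hs := h.lt s
  by_cases hl : b f = b s
  · have h1 : ¬ PassesBelow a b f (b s) := fun h' => by
      have := h'.1.2; rw [hl] at this; exact lt_irrefl _ this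
    have key : ∀ x, x < (b s).1 → (lineHeight (a f) (b f) x < lineHeight (a s) (b s) x ↔
        -planeSlope (a f) (b f) < -planeSlope (a s) (b s)) := by
      intro x hx
      rw [lineHeight_eq_right hf, lineHeight_eq_right hs, hl, add_lt_add_iff_left, neg_lt_neg_iff,
        mul_lt_mul_left_of_neg (by linarith)]
    simp only [h1, false_or, hl, true_and, le_refl, and_true]
    rw [← hl]
    constructor
    · rintro ⟨x, hx, hx', hlt⟩
      have := (key x hx'.2).1 hlt
      rwa [← hl] at this
    · intro hlt
      obtain ⟨x, hx1, hx2⟩ := exists_between (show max (a f).1 (a s).1 < (b s).1 by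
        rw [max_lt_iff]; exact ⟨by rw [← hl]; exact hf, hs⟩)
      rw [max_lt_iff] at hx1
      exact ⟨x, ⟨hx1.1, by rw [hl]; exact hx2⟩, ⟨hx1.2, hx2⟩, (key x hx2).2 (by rwa [← hl])⟩
  · simp only [hl, false_and, or_false]
    constructor
    · rintro ⟨⟨x, hx, hx', hlt⟩, hle⟩
      have h1 : (b s).1 < (b f).1 := lt_of_le_of_ne hle fun he => hl (h.inj_right _ _ he.symm)
      have h2 : (a f).1 < (b s).1 := by linarith
      refine ⟨⟨h2, h1⟩, ?_⟩
      have := h.lineHeight_lt_of_lt hfs (y := (b s).1) ⟨hx.1.le, hx.2.le⟩ ⟨hx'.1.le, hx'.2.le⟩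
        ⟨h2.le, h1.le⟩ ⟨hs.le, le_rfl⟩ (Or.inl ⟨h2, h1⟩) hlt
      rwa [lineHeight_right hs] at this
    · rintro ⟨h1, h2⟩
      refine ⟨h.isBelow_of_lineHeight_lt hfs ⟨h1.1.le, h1.2.le⟩ ⟨hs.le, le_rfl⟩ (Or.inl h1) ?_,
        h1.2.le⟩
      rwa [lineHeight_right hs]

theorem planeSlope_ne_of_left_eq {f s : S} (hfs : f ≠ s) (hl : a f = a s) :
    planeSlope (a f) (b f) ≠ planeSlope (a s) (b s) := by
  intro he
  have hf := h.lt f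
  have hs := h.lt s
  obtain ⟨x, hx1, hx2⟩ := exists_between (show (a s).1 < min (b f).1 (b s).1 by
    rw [lt_min_iff]; exact ⟨by rw [← hl]; exact hf, hs⟩)
  rw [lt_min_iff] at hx2
  obtain ⟨-, k | k⟩ := h.eq_end_of_lineHeight_eq hfs (x := x) ⟨by rw [hl]; exact hx1.le, hx2.1.le⟩
    ⟨hx1.le, hx2.2.le⟩ (by rw [lineHeight, lineHeight, he, hl]) <;> linarith

theorem planeSlope_ne_of_right_eq {f s : S} (hfs : f ≠ s) (hl : b f = b s) :
    planeSlope (a f) (b f) ≠ planeSlope (a s) (b s) := by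
  intro he
  have hf := h.lt f
  have hs := h.lt s
  obtain ⟨x, hx1, hx2⟩ := exists_between (show max (a f).1 (a s).1 < (b s).1 by
    rw [max_lt_iff]; exact ⟨by rw [← hl]; exact hf, hs⟩)
  rw [max_lt_iff] at hx1
  obtain ⟨-, k | k⟩ := h.eq_end_of_lineHeight_eq hfs (x := x) ⟨hx1.1.le, by rw [hl]; exact hx2.le⟩
    ⟨hx1.2.le, hx2.le⟩ (by rw [lineHeight_eq_right hf, lineHeight_eq_right hs, he, hl]) <;> linarith

end IsSegmentSystem

end SegmentSystem

/-! ### Faces of a segment system -/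

/-- Ordering `A` by `κ`, the partial sums of `e` before and after each element of `A` pair up over
`𝔽₂`, and only the first and the last one remain. -/
theorem sum_telescope_of_injOn {S M : Type*} [AddCommGroup M] [DecidableEq S]
    (κ : S → ℝ) (e : S → M) (g : M → ZMod 2) (m : M) (A : Finset S)
    (hκ : Set.InjOn κ A) :
    ∑ s ∈ A, (g (m + ∑ f ∈ A with κ f < κ s, e f) + g (m + ∑ f ∈ A with κ f < κ s, e f + e s)) =
      g m + g (m + ∑ f ∈ A, e f) := by
  induction A using Finset.induction_on_max_value κ with
  | empty => simp [CharTwo.add_self_eq_zero]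
  | insert x A hx hmax ih =>
    have hlt : ∀ y ∈ A, κ y < κ x := fun y hy => lt_of_le_of_ne (hmax y hy) fun he =>
      hx (hκ (by simp [hy]) (by simp) he ▸ hy)
    rw [sum_insert hx, sum_insert (f := e) hx]
    have h1 : ({f ∈ insert x A | κ f < κ x} : Finset S) = A := by
      ext f; simp only [mem_filter, mem_insert]
      constructor
      · rintro ⟨rfl | h, h'⟩
        · exact absurd h' (lt_irrefl _)
        · exact h
      · intro h; exact ⟨Or.inr h, hlt f h⟩
    have h2 : ∀ s ∈ A, ({f ∈ insert x A | κ f < κ s} : Finset S) = {f ∈ A | κ f < κ s} := by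
      intro s hs
      ext f; simp only [mem_filter, mem_insert]
      constructor
      · rintro ⟨rfl | h, h'⟩
        · exact absurd h' (hlt s hs).not_gt
        · exact ⟨h, h'⟩
      · rintro ⟨h, h'⟩; exact ⟨Or.inr h, h'⟩
    have h3 := ih (hκ.mono (by simp))
    rw [← sum_congr rfl fun s hs => by rw [← h2 s hs]] at h3
    rw [h1, h3, add_comm (e x), ← add_assoc m]
    have := CharTwo.add_self_eq_zero (g (m + ∑ f ∈ A, e f))
    linear_combination this

namespace IsSegmentSystem

open Classical in
/-- The parity of the number of segments of `z` that run below `s`, as a functional of the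
element `z` of the cycle space. The lower side of `s` lies in the face with this parity function. -/
noncomputable def lowerSide {S : Type*} [Fintype S] (a b : S → ℝ × ℝ) (s : S) :
    cycleSpace a b → ZMod 2 :=
  fun z => ∑ f with IsBelow a b f s ∧ (a f).1 ≤ (a s).1, z.1 f

open Classical in
/-- The boundary of the face with parity function `F`: the segments exactly one side of which
lies in that face. -/
noncomputable def faceBoundary {S : Type*} [Fintype S] (a b : S → ℝ × ℝ)
    (F : cycleSpace a b → ZMod 2) (s : S) : ZMod 2 :=
  (if lowerSide a b s = F then 1 else 0) +
    (if (lowerSide a b s + fun z => z.1 s) = F then 1 else 0)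

variable {S : Type*} [Fintype S] {a b : S → ℝ × ℝ} (h : IsSegmentSystem a b)
include h

open Classical in
/-- The parity below a segment is the same at both its ends, as `z` has even degree at each of
the points in the region below the segment. -/
theorem lowerSide_eq_sum_right (s : S) :
    lowerSide a b s = fun z => ∑ f with IsBelow a b f s ∧ (b s).1 ≤ (b f).1, z.1 f := by
  funext z
  have hz := mem_cycleSpace.1 z.2
  set P : Finset (ℝ × ℝ) := univ.image a ∪ univ.image b with hP
  have h0 : ∑ p ∈ P with IsPointBelow a b p s,
      ∑ f, ((if a f = p then z.1 f else 0) + (if b f = p then z.1 f else 0)) = 0 :=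
    sum_eq_zero fun p _ => hz p
  rw [sum_comm] at h0
  have h1 : ∀ f, ∑ p ∈ P with IsPointBelow a b p s,
      ((if a f = p then z.1 f else 0) + (if b f = p then z.1 f else 0)) =
      (if IsPointBelow a b (a f) s then z.1 f else 0) +
        (if IsPointBelow a b (b f) s then z.1 f else 0) := by
    intro f
    rw [sum_add_distrib, sum_ite_eq, sum_ite_eq]
    simp [hP]
  simp only [h1] at h0
  have h2 : ∀ f, (if IsPointBelow a b (a f) s then z.1 f else 0) +
        (if IsPointBelow a b (b f) s then z.1 f else 0) =
      (if IsBelow a b f s ∧ (a f).1 ≤ (a s).1 then z.1 f else 0) +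
        (if IsBelow a b f s ∧ (b s).1 ≤ (b f).1 then z.1 f else 0) := by
    intro f
    have two : z.1 f + z.1 f = 0 := CharTwo.add_self_eq_zero _
    by_cases hfs : f = s
    · subst hfs
      simp [not_isBelow_self, IsPointBelow]
    rw [h.isPointBelow_left_iff hfs, h.isPointBelow_right_iff hfs]
    by_cases hB : IsBelow a b f s
    · simp only [hB, true_and]
      by_cases c1 : (a f).1 ≤ (a s).1 <;> by_cases c2 : (b s).1 ≤ (b f).1 <;>
        simp [c1, c2, not_lt.2, not_le.1, two]
    · simp [hB]
  simp only [h2, sum_add_distrib, ← sum_filter] at h0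
  rw [lowerSide]
  exact CharTwo.add_eq_zero.1 h0

open Classical in
theorem lowerSide_left (s : S) : lowerSide a b s =
    (fun z => ∑ f with PassesBelow a b f (a s), z.1 f) +
      ∑ f ∈ univ.filter (fun f => a f = a s) with
        planeSlope (a f) (b f) < planeSlope (a s) (b s), fun z => z.1 f := by
  funext z
  rw [lowerSide, Pi.add_apply, Finset.sum_apply, filter_filter, ← sum_union]
  · congr 1
    ext f
    simp only [mem_filter, mem_univ, true_and, mem_union, h.isBelow_and_left_le_iff]
  · rw [disjoint_left]
    simp only [mem_filter, mem_univ, true_and]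
    rintro f hf ⟨h1, -⟩
    exact lt_irrefl _ (h1 ▸ hf.1.1)

open Classical in
theorem lowerSide_right (s : S) : lowerSide a b s =
    (fun z => ∑ f with PassesBelow a b f (b s), z.1 f) +
      ∑ f ∈ univ.filter (fun f => b f = b s) with
        -planeSlope (a f) (b f) < -planeSlope (a s) (b s), fun z => z.1 f := by
  rw [h.lowerSide_eq_sum_right]
  funext z
  rw [Pi.add_apply, Finset.sum_apply, filter_filter, ← sum_union]
  · congr 1
    ext f
    simp only [mem_filter, mem_univ, true_and, mem_union, h.isBelow_and_le_right_iff]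
  · rw [disjoint_left]
    simp only [mem_filter, mem_univ, true_and]
    rintro f hf ⟨h1, -⟩
    exact lt_irrefl _ (h1 ▸ hf.1.2)

open Classical in
/-- At a point `p`, consecutive segments starting in `p` have a common face between them, and so
have consecutive segments ending in `p`; the two outer faces also match. Hence each face boundary
has even degree at `p`. -/
theorem faceBoundary_mem (F : cycleSpace a b → ZMod 2) :
    faceBoundary a b F ∈ cycleSpace a b := by
  rw [mem_cycleSpace]
  intro p
  rw [sum_add_distrib, ← sum_filter, ← sum_filter]
  set m : cycleSpace a b → ZMod 2 := fun z => ∑ f with PassesBelow a b f p, z.1 f with hm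
  set g : (cycleSpace a b → ZMod 2) → ZMod 2 := fun G => if G = F then 1 else 0 with hg
  have h1 : ∑ s with a s = p, faceBoundary a b F s =
      g m + g (m + ∑ f with a f = p, fun z => z.1 f) := by
    rw [← sum_telescope_of_injOn (fun s => planeSlope (a s) (b s))]
    · refine sum_congr rfl fun s hs => ?_
      have hs : a s = p := (mem_filter.1 hs).2
      have := h.lowerSide_left s
      rw [hs] at this
      rw [faceBoundary, this, hs, add_assoc]
    · intro f hf s hs hfs
      simp only [coe_filter, mem_univ, true_and, Set.mem_ofPred_eq] at hf hs
      by_contra hne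
      exact h.planeSlope_ne_of_left_eq hne (hf.trans hs.symm) hfs
  have h2 : ∑ s with b s = p, faceBoundary a b F s =
      g m + g (m + ∑ f with b f = p, fun z => z.1 f) := by
    rw [← sum_telescope_of_injOn (fun s => -planeSlope (a s) (b s))]
    · refine sum_congr rfl fun s hs => ?_
      have hs : b s = p := (mem_filter.1 hs).2
      have := h.lowerSide_right s
      rw [hs] at this
      rw [faceBoundary, this, hs, add_assoc]
    · intro f hf s hs hfs
      simp only [coe_filter, mem_univ, true_and, Set.mem_ofPred_eq] at hf hs
      by_contra hne
      exact h.planeSlope_ne_of_right_eq hne (hf.trans hs.symm) (neg_injective hfs)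
  have h3 : (∑ f with a f = p, fun z : cycleSpace a b => z.1 f) =
      ∑ f with b f = p, fun z => z.1 f := by
    funext z
    have := mem_cycleSpace.1 z.2 p
    rw [sum_add_distrib, ← sum_filter, ← sum_filter] at this
    rw [Finset.sum_apply, Finset.sum_apply]
    exact CharTwo.add_eq_zero.1 this
  rw [h1, h2, h3]
  exact CharTwo.add_self_eq_zero _

open Classical in
/-- The face boundaries span the cycle space and contain each segment at most twice. -/
theorem exists_isTwoSpanning : ∃ T, IsTwoSpanning a b T := by
  refine ⟨univ.image (faceBoundary a b), ?_, ?_, ?_⟩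
  · intro z hz
    obtain ⟨F, -, rfl⟩ := mem_image.1 hz
    exact h.faceBoundary_mem F
  · intro z hz
    -- `z` is the sum of the boundaries of the faces on which its parity is odd
    have : z = ∑ F : cycleSpace a b → ZMod 2, F ⟨z, hz⟩ • faceBoundary a b F := by
      funext s
      rw [Finset.sum_apply]
      simp only [Pi.smul_apply, smul_eq_mul, faceBoundary, mul_add, mul_ite, mul_one, mul_zero,
        sum_add_distrib, sum_ite_eq, mem_univ, if_true, Pi.add_apply]
      rw [← add_assoc, CharTwo.add_self_eq_zero, zero_add]
    rw [this]
    refine Submodule.sum_mem _ fun F _ => Submodule.smul_mem _ _ (Submodule.subset_span ?_)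
    simp
  · intro s
    refine (card_le_card (t := ({lowerSide a b s, lowerSide a b s + fun z => z.1 s} :
      Finset (cycleSpace a b → ZMod 2)).image (faceBoundary a b)) ?_).trans
      (card_image_le.trans card_le_two)
    intro z hz
    obtain ⟨hz, hne⟩ := mem_filter.1 hz
    obtain ⟨F, -, rfl⟩ := mem_image.1 hz
    refine mem_image_of_mem _ ?_
    by_contra hF
    simp only [mem_insert, mem_singleton, not_or] at hF
    exact hne (by simp [faceBoundary, Ne.symm hF.1, Ne.symm hF.2])

end IsSegmentSystem

/-! ### General position -/

theorem exists_injOn_add_mul (P : Finset (ℝ × ℝ)) :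
    ∃ c : ℝ, Set.InjOn (fun p : ℝ × ℝ => p.1 + c * p.2) P := by
  classical
  obtain ⟨c, hc⟩ := Infinite.exists_notMem_finset
    ((P ×ˢ P).image fun q => (q.2.1 - q.1.1) / (q.1.2 - q.2.2))
  refine ⟨c, fun p hp q hq hpq => ?_⟩
  simp only at hpq
  by_cases h2 : p.2 = q.2
  · ext
    · rw [h2] at hpq; linarith
    · exact h2
  · exfalso
    refine hc (mem_image.2 ⟨(p, q), mem_product.2 ⟨hp, hq⟩, ?_⟩)
    have : p.2 - q.2 ≠ 0 := sub_ne_zero.2 h2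
    rw [div_eq_iff this]
    linarith

/-- The shear `(x, y) ↦ (x + c * y, y)`. -/
def planeShear (c : ℝ) : ℝ × ℝ →ₗ[ℝ] ℝ × ℝ :=
  (LinearMap.fst ℝ ℝ ℝ + c • LinearMap.snd ℝ ℝ ℝ).prod (LinearMap.snd ℝ ℝ ℝ)

theorem planeShear_apply (c : ℝ) (p : ℝ × ℝ) : planeShear c p = (p.1 + c * p.2, p.2) := rfl

theorem planeShear_injective (c : ℝ) : Function.Injective (planeShear c) := by
  intro p q h
  simp only [planeShear_apply, Prod.mk.injEq] at h
  ext
  · have := h.1; rw [h.2] at this; linarith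
  · exact h.2

theorem IsTwoSpanning.congr {S P Q : Type*} [Fintype S] [DecidableEq P] [DecidableEq Q]
    {a b : S → P} {a' b' : S → Q} {T : Finset (S → ZMod 2)} (hT : IsTwoSpanning a b T)
    (h : cycleSpace a b = cycleSpace a' b') : IsTwoSpanning a' b' T :=
  ⟨fun z hz => h ▸ hT.mem z hz, h ▸ hT.le_span, hT.card_le⟩

theorem cycleSpace_eq_of_injective {S P Q : Type*} [Fintype S] [DecidableEq P] [DecidableEq Q]
    {a b : S → P} {a' b' : S → Q} (g : P → Q) (hg : Function.Injective g)
    (h : ∀ s, (a' s = g (a s) ∧ b' s = g (b s)) ∨ (a' s = g (b s) ∧ b' s = g (a s))) :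
    cycleSpace a' b' = cycleSpace a b := by
  have key : ∀ (z : S → ZMod 2) q,
      ∑ s, ((if a' s = q then z s else 0) + (if b' s = q then z s else 0)) =
      ∑ s, ((if g (a s) = q then z s else 0) + (if g (b s) = q then z s else 0)) := by
    intro z q
    refine sum_congr rfl fun s _ => ?_
    rcases h s with ⟨h1, h2⟩ | ⟨h1, h2⟩
    · rw [h1, h2]
    · rw [h1, h2, add_comm]
  ext z
  simp only [mem_cycleSpace, key]
  constructor
  · intro hz p
    simpa only [hg.eq_iff] using hz (g p)
  · intro hz q
    by_cases hq : ∃ p, g p = q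
    · obtain ⟨p, rfl⟩ := hq
      simpa only [hg.eq_iff] using hz p
    · push Not at hq
      exact sum_eq_zero fun s _ => by simp [hq]

/-- Finitely many nondegenerate segments that meet only in common ends can be put in general
position by a shear. -/
theorem exists_isTwoSpanning_of_segments {S : Type*} [Fintype S]
    (a b : S → ℝ × ℝ) (hne : ∀ s, a s ≠ b s)
    (hinter : ∀ s t, s ≠ t → ∀ x, x ∈ segment ℝ (a s) (b s) → x ∈ segment ℝ (a t) (b t) →
      x = a s ∨ x = b s) :
    ∃ T, IsTwoSpanning a b T := by
  classical
  set P : Finset (ℝ × ℝ) := univ.image a ∪ univ.image b with hP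
  obtain ⟨c, hc⟩ := exists_injOn_add_mul P
  have haP : ∀ s, a s ∈ P := fun s => by simp [hP]
  have hbP : ∀ s, b s ∈ P := fun s => by simp [hP]
  have hcne : ∀ s, (planeShear c (a s)).1 ≠ (planeShear c (b s)).1 := fun s he =>
    hne s (hc (haP s) (hbP s) he)
  set a' : S → ℝ × ℝ := fun s => if (planeShear c (a s)).1 < (planeShear c (b s)).1 then
    planeShear c (a s) else planeShear c (b s) with ha'
  set b' : S → ℝ × ℝ := fun s => if (planeShear c (a s)).1 < (planeShear c (b s)).1 then
    planeShear c (b s) else planeShear c (a s) with hb'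
  have hor : ∀ s, (a' s = planeShear c (a s) ∧ b' s = planeShear c (b s)) ∨
      (a' s = planeShear c (b s) ∧ b' s = planeShear c (a s)) := by
    intro s
    by_cases hs : (planeShear c (a s)).1 < (planeShear c (b s)).1
    · left; simp [ha', hb', hs]
    · right; simp [ha', hb', hs]
  have hseg : ∀ s, segment ℝ (a' s) (b' s) = planeShear c '' segment ℝ (a s) (b s) := by
    intro s
    have := image_segment ℝ (planeShear c).toAffineMap (a s) (b s)
    simp only [LinearMap.coe_toAffineMap] at this
    rw [this]
    rcases hor s with ⟨h1, h2⟩ | ⟨h1, h2⟩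
    · rw [h1, h2]
    · rw [h1, h2, segment_symm]
  have hinj : ∀ p ∈ P, ∀ q ∈ P, (planeShear c p).1 = (planeShear c q).1 →
      planeShear c p = planeShear c q := fun p hp q hq he => by rw [hc hp hq he]
  have ha2 : ∀ s, ∃ p ∈ P, a' s = planeShear c p := fun s => by
    rcases hor s with ⟨h1, h2⟩ | ⟨h1, h2⟩
    exacts [⟨_, haP s, h1⟩, ⟨_, hbP s, h1⟩]
  have hb2 : ∀ s, ∃ p ∈ P, b' s = planeShear c p := fun s => by
    rcases hor s with ⟨h1, h2⟩ | ⟨h1, h2⟩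
    exacts [⟨_, hbP s, h2⟩, ⟨_, haP s, h2⟩]
  have hsys : IsSegmentSystem a' b' := by
    constructor
    · intro s
      have := hcne s
      by_cases hs : (planeShear c (a s)).1 < (planeShear c (b s)).1
      · simp [ha', hb', hs]
      · simp only [ha', hb', hs, if_false]
        exact lt_of_le_of_ne (not_lt.1 hs) this.symm
    · intro s t hst x hx hy
      rw [hseg] at hx hy
      obtain ⟨x, hx, rfl⟩ := hx
      obtain ⟨y, hy, hyx⟩ := hy
      obtain rfl := planeShear_injective c hyx
      rcases hor s with ⟨h1, h2⟩ | ⟨h1, h2⟩ <;> rw [h1, h2] <;>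
        rcases hinter s t hst _ hx hy with rfl | rfl <;> simp
    · intro s t he
      obtain ⟨p, hp, h1⟩ := ha2 s
      obtain ⟨q, hq, h2⟩ := ha2 t
      rw [h1, h2] at he ⊢
      exact hinj p hp q hq he
    · intro s t he
      obtain ⟨p, hp, h1⟩ := hb2 s
      obtain ⟨q, hq, h2⟩ := hb2 t
      rw [h1, h2] at he ⊢
      exact hinj p hp q hq he
    · intro s t he
      obtain ⟨p, hp, h1⟩ := ha2 s
      obtain ⟨q, hq, h2⟩ := hb2 t
      rw [h1, h2] at he ⊢
      exact hinj p hp q hq he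
  obtain ⟨T, hT⟩ := hsys.exists_isTwoSpanning
  exact ⟨T, hT.congr (cycleSpace_eq_of_injective _ (planeShear_injective c) hor)⟩

/-! ### The cycle space of a plane graph -/

/-- The cycle space of a simple graph, the ends of each edge being listed in an arbitrary order. -/
noncomputable abbrev SimpleGraph.cycleSpace {V : Type*} (G : SimpleGraph V) [Fintype G.edgeSet]
    [DecidableEq V] : Submodule (ZMod 2) (G.edgeSet → ZMod 2) :=
  _root_.cycleSpace (fun e : G.edgeSet => e.1.out.1) (fun e : G.edgeSet => e.1.out.2)

theorem sum_zmod_two_telescope {P : Type*} [DecidableEq P] (p : ℕ → P) (x : P) (n : ℕ) :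
    ∑ i : Fin n, ((if p i = x then (1 : ZMod 2) else 0) + (if p (i + 1) = x then 1 else 0)) =
      (if p 0 = x then 1 else 0) + (if p n = x then 1 else 0) := by
  rw [Fin.sum_univ_eq_sum_range
    (fun i => (if p i = x then (1 : ZMod 2) else 0) + (if p (i + 1) = x then 1 else 0))]
  induction n with
  | zero => simp [CharTwo.add_self_eq_zero]
  | succ n ih =>
    rw [sum_range_succ, ih]
    have := CharTwo.add_self_eq_zero (if p n = x then (1 : ZMod 2) else 0)
    linear_combination this

section PolygonalArc

variable {p : ℕ → ℝ × ℝ} {n : ℕ} (h1 : ∀ i < n, p i ≠ p (i + 1))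
  (h2 : ∀ i, i + 1 < n →
    segment ℝ (p i) (p (i + 1)) ∩ segment ℝ (p (i + 1)) (p (i + 2)) = {p (i + 1)})
  (h3 : ∀ i j, i + 1 < j → j < n →
    Disjoint (segment ℝ (p i) (p (i + 1))) (segment ℝ (p j) (p (j + 1))))
include h2 h3

/-- Two segments of a polygonal arc meet only in common ends. -/
theorem eq_end_of_mem_two_segments {i j : ℕ} (hij : i ≠ j) (hi : i < n) (hj : j < n)
    {x : ℝ × ℝ} (hx : x ∈ segment ℝ (p i) (p (i + 1))) (hy : x ∈ segment ℝ (p j) (p (j + 1))) :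
    x = p i ∨ x = p (i + 1) := by
  rcases lt_trichotomy (i + 1) j with h | h | h
  · exact absurd hy (Set.disjoint_left.1 (h3 i j h hj) hx)
  · subst h
    have : x ∈ segment ℝ (p i) (p (i + 1)) ∩ segment ℝ (p (i + 1)) (p (i + 2)) := ⟨hx, hy⟩
    rw [h2 i hj] at this
    exact Or.inr this
  · rcases lt_trichotomy (j + 1) i with h' | h' | h'
    · exact absurd hx (Set.disjoint_left.1 (h3 j i h' hi) hy)
    · subst h'
      have : x ∈ segment ℝ (p j) (p (j + 1)) ∩ segment ℝ (p (j + 1)) (p (j + 2)) := ⟨hy, hx⟩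
      rw [h2 j hi] at this
      exact Or.inl this
    · omega

include h1

theorem ne_of_lt_of_polygonalArc {i j : ℕ} (hij : i < j) (hj : j ≤ n) : p i ≠ p j := by
  intro he
  obtain ⟨j, rfl⟩ : ∃ k, j = k + 1 := ⟨j - 1, by omega⟩
  rcases Nat.lt_trichotomy (i + 1) j with h | h | h
  · refine Set.disjoint_left.1 (h3 i j h (by omega)) (left_mem_segment ℝ _ _) ?_
    rw [he]; exact right_mem_segment ℝ _ _
  · subst h
    have : p i ∈ segment ℝ (p i) (p (i + 1)) ∩ segment ℝ (p (i + 1)) (p (i + 2)) :=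
      ⟨left_mem_segment ℝ _ _, by rw [he]; exact right_mem_segment ℝ _ _⟩
    rw [h2 i (by omega)] at this
    exact h1 i (by omega) this
  · obtain rfl : i = j := by omega
    exact h1 i (by omega) he

end PolygonalArc

/-- The faces of the drawing cut at its bends give the two-spanning set: an element of the cycle
space of the subdivided graph is constant along each arc. -/
theorem PlaneEmbedding.exists_isTwoSpanning {V : Type*} [DecidableEq V] {G : SimpleGraph V}
    [Fintype G.edgeSet] (E : PlaneEmbedding G) :
    ∃ T, IsTwoSpanning (fun e : G.edgeSet => e.1.out.1) (fun e : G.edgeSet => e.1.out.2) T := by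
  classical
  have hout : ∀ e : G.edgeSet, s(e.1.out.1, e.1.out.2) = e.1 := fun e => Quot.out_eq e.1
  have hmem : ∀ (e : G.edgeSet) v, v ∈ e.1 ↔ v = e.1.out.1 ∨ v = e.1.out.2 := fun e v => by
    conv_lhs => rw [← hout e, Sym2.mem_iff]
  have harc : ∀ e : G.edgeSet, IsPolygonalArc (E.arc e.1) (E.pos e.1.out.1) (E.pos e.1.out.2) := by
    intro e
    have := E.isPolygonalArc e.1.out.1 e.1.out.2 (by
      rw [← SimpleGraph.mem_edgeSet, hout]; exact e.2)
    rwa [hout] at this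
  choose n p hn hp0 hpn hA h1 h2 h3 using harc
  let S := Σ e : G.edgeSet, Fin (n e)
  let a : S → ℝ × ℝ := fun s => p s.1 s.2
  let b : S → ℝ × ℝ := fun s => p s.1 (s.2 + 1)
  have hsub : ∀ (e : G.edgeSet) i, i < n e → ∀ x ∈ segment ℝ (p e i) (p e (i + 1)),
      x ∈ E.arc e.1 := by
    intro e i hi x hx
    rw [hA e]
    exact ⟨i, hi, hx⟩
  -- an end of an arc that lies on one of its segments is an end of that segment
  have hend : ∀ (e : G.edgeSet) i, i < n e → ∀ j, j = 0 ∨ j = n e →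
      p e j ∈ segment ℝ (p e i) (p e (i + 1)) → p e j = p e i ∨ p e j = p e (i + 1) := by
    rintro e i hi j (rfl | rfl) hx
    · by_cases h0 : i = 0
      · subst h0; left; rfl
      · exact eq_end_of_mem_two_segments (h2 e) (h3 e) h0 hi (hn e) hx (left_mem_segment ℝ _ _)
    · by_cases h0 : i = n e - 1
      · subst h0; right; rw [Nat.sub_add_cancel (hn e)]
      · refine eq_end_of_mem_two_segments (h2 e) (h3 e) h0 hi (j := n e - 1)
          (by have := hn e; omega) hx ?_
        rw [Nat.sub_add_cancel (hn e)]
        exact right_mem_segment ℝ _ _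
  have hcross : ∀ (e f : G.edgeSet), e ≠ f → ∀ x, x ∈ E.arc e.1 → x ∈ E.arc f.1 →
      ∃ j, (j = 0 ∨ j = n e) ∧ x = p e j := by
    intro e f hef x hxe hxf
    obtain ⟨v, hv, -, rfl⟩ := E.arc_inter e.1 e.2 f.1 f.2 (fun he => hef (Subtype.ext he)) x hxe hxf
    rcases (hmem e v).1 hv with rfl | rfl
    · exact ⟨0, Or.inl rfl, (hp0 e).symm⟩
    · exact ⟨n e, Or.inr rfl, (hpn e).symm⟩
  obtain ⟨T, hT⟩ := exists_isTwoSpanning_of_segments a b (fun s => h1 s.1 s.2 s.2.2) (by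
    rintro ⟨e, i⟩ ⟨f, j⟩ hst x hx hy
    by_cases hef : e = f
    · subst hef
      have hij : (i : ℕ) ≠ j := fun h => hst (by rw [Fin.ext h])
      exact eq_end_of_mem_two_segments (h2 e) (h3 e) hij i.2 j.2 hx hy
    · obtain ⟨k, hk, rfl⟩ := hcross e f hef x (hsub e i i.2 x hx) (hsub f j j.2 x hy)
      exact hend e i i.2 k hk hx)
  have hconst : ∀ B ∈ cycleSpace a b, ∀ (e : G.edgeSet) (i : ℕ) (hi : i < n e),
      B ⟨e, ⟨i, hi⟩⟩ = B ⟨e, ⟨0, hn e⟩⟩ := by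
    intro B hB e i
    induction i with
    | zero => intro hi; rfl
    | succ i ih =>
      intro hi
      rw [← ih (by omega)]
      have hz := mem_cycleSpace.1 hB (p e (i + 1))
      have hne0 : ∀ k, k = 0 ∨ k = n e → p e (i + 1) ≠ p e k := by
        rintro k (rfl | rfl)
        · exact (ne_of_lt_of_polygonalArc (h1 e) (h2 e) (h3 e) (by omega) (by omega)).symm
        · exact ne_of_lt_of_polygonalArc (h1 e) (h2 e) (h3 e) (by omega) (by omega)
      have honarc : p e (i + 1) ∈ E.arc e.1 := hsub e (i + 1) hi _ (left_mem_segment ℝ _ _)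
      rw [Fintype.sum_eq_add (⟨e, ⟨i, by omega⟩⟩ : S) ⟨e, ⟨i + 1, hi⟩⟩ (by simp)] at hz
      · have i1 : p e i ≠ p e (i + 1) := h1 e i (by omega)
        have i2 : p e (i + 1 + 1) ≠ p e (i + 1) := (h1 e (i + 1) hi).symm
        simp only [a, b, i1, i2, if_true, if_false, zero_add, add_zero] at hz
        exact (CharTwo.add_eq_zero.1 hz).symm
      · rintro ⟨f, j⟩ ⟨hj1, hj2⟩
        have hnot : p f j ≠ p e (i + 1) ∧ p f (j + 1) ≠ p e (i + 1) := by
          by_cases hfe : f = e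
          · subst hfe
            have hj1 : (j : ℕ) ≠ i := fun h => hj1 (congrArg (Sigma.mk f) (Fin.ext h))
            have hj2 : (j : ℕ) ≠ i + 1 := fun h => hj2 (congrArg (Sigma.mk f) (Fin.ext h))
            have hj := j.2
            constructor
            · rcases lt_or_gt_of_ne hj2 with h | h
              · exact ne_of_lt_of_polygonalArc (h1 f) (h2 f) (h3 f) h (by omega)
              · exact (ne_of_lt_of_polygonalArc (h1 f) (h2 f) (h3 f) h (by omega)).symm
            · rcases lt_or_gt_of_ne hj1 with h | h
              · exact ne_of_lt_of_polygonalArc (h1 f) (h2 f) (h3 f) (by omega) (by omega)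
              · exact (ne_of_lt_of_polygonalArc (h1 f) (h2 f) (h3 f) (by omega) (by omega)).symm
          · constructor
            · intro he
              obtain ⟨k, hk, hk'⟩ := hcross e f (Ne.symm hfe) _ honarc
                (he ▸ hsub f j j.2 _ (left_mem_segment ℝ _ _))
              exact hne0 k hk hk'
            · intro he
              obtain ⟨k, hk, hk'⟩ := hcross e f (Ne.symm hfe) _ honarc
                (he ▸ hsub f j j.2 _ (right_mem_segment ℝ _ _))
              exact hne0 k hk hk'
        simp [a, b, hnot.1, hnot.2]
  have hsum : ∀ (B : S → ZMod 2) (z : G.edgeSet → ZMod 2), (∀ s : S, B s = z s.1) → ∀ x,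
      ∑ s, ((if a s = x then B s else 0) + (if b s = x then B s else 0)) =
      ∑ e : G.edgeSet, ((if E.pos e.1.out.1 = x then z e else 0) +
        (if E.pos e.1.out.2 = x then z e else 0)) := by
    intro B z hBz x
    rw [Fintype.sum_sigma]
    refine sum_congr rfl fun e _ => ?_
    have := congrArg (z e * ·) (sum_zmod_two_telescope (p e) x (n e))
    simp only [mul_sum, hp0, hpn, mul_add, mul_ite, mul_one, mul_zero] at this
    rw [← this]
    refine sum_congr rfl fun i _ => ?_
    rw [hBz]
  let r : (S → ZMod 2) →ₗ[ZMod 2] (G.edgeSet → ZMod 2) :=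
    LinearMap.funLeft (ZMod 2) (ZMod 2) (fun e => (⟨e, ⟨0, hn e⟩⟩ : S))
  refine ⟨T.image r, ?_, ?_, ?_⟩
  · intro z hz
    obtain ⟨B, hB, rfl⟩ := mem_image.1 hz
    rw [mem_cycleSpace]
    intro v
    have := mem_cycleSpace.1 (hT.mem B hB) (E.pos v)
    rw [hsum B (r B) (fun s => hconst B (hT.mem B hB) s.1 s.2 s.2.2)] at this
    simpa only [E.pos_injective.eq_iff] using this
  · intro z hz
    have hl : (fun s : S => z s.1) ∈ cycleSpace a b := by
      rw [mem_cycleSpace]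
      intro x
      rw [hsum _ z (fun s => rfl)]
      by_cases hx : ∃ v, E.pos v = x
      · obtain ⟨v, rfl⟩ := hx
        have := mem_cycleSpace.1 hz v
        simpa only [E.pos_injective.eq_iff] using this
      · push Not at hx
        exact sum_eq_zero fun e _ => by simp [hx]
    have := Submodule.mem_map_of_mem (f := r) (hT.le_span hl)
    rw [Submodule.map_span] at this
    rw [coe_image]
    exact this
  · intro e
    refine le_trans (card_le_card (t := ({z ∈ T | z ⟨e, ⟨0, hn e⟩⟩ ≠ 0} : Finset _).image r) ?_)
      (card_image_le.trans (hT.card_le _))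
    intro z hz
    obtain ⟨hz, hne⟩ := mem_filter.1 hz
    obtain ⟨B, hB, rfl⟩ := mem_image.1 hz
    exact mem_image_of_mem _ (mem_filter.2 ⟨hB, hne⟩)

/-! ### Counting edges of a plane graph -/

/-- The edge `uv` belongs to the set of edges `z`. -/
def EdgeIn {V : Type*} {G : SimpleGraph V} (z : G.edgeSet → ZMod 2) (u v : V) : Prop :=
  ∃ h : s(u, v) ∈ G.edgeSet, z ⟨_, h⟩ ≠ 0

theorem EdgeIn.symm {V : Type*} {G : SimpleGraph V} {z : G.edgeSet → ZMod 2} {u v : V}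
    (h : EdgeIn z u v) : EdgeIn z v u := by
  unfold EdgeIn at *
  rwa [Sym2.eq_swap]

section Counting

variable {V : Type*} [DecidableEq V] {G : SimpleGraph V} [Fintype G.edgeSet]

/-- The incidence map has the cycle space as kernel, and its range lies in the hyperplane of vectors
with sum zero. -/
theorem SimpleGraph.card_edgeSet_lt_add_finrank_cycleSpace [Fintype V] [Nonempty V] :
    Fintype.card G.edgeSet < Fintype.card V + Module.finrank (ZMod 2) G.cycleSpace := by
  let inc : (G.edgeSet → ZMod 2) →ₗ[ZMod 2] (V → ZMod 2) :=
    LinearMap.pi fun v => ∑ e : G.edgeSet,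
      ((if e.1.out.1 = v then 1 else 0) + (if e.1.out.2 = v then 1 else 0) : ZMod 2) •
        LinearMap.proj e
  have hinc : ∀ z v, inc z v = ∑ e : G.edgeSet,
      ((if e.1.out.1 = v then z e else 0) + (if e.1.out.2 = v then z e else 0)) := by
    intro z v
    simp only [inc, LinearMap.pi_apply, LinearMap.sum_apply, LinearMap.smul_apply,
      LinearMap.proj_apply, smul_eq_mul, add_mul, ite_mul, one_mul, zero_mul]
  have hker : inc.ker = G.cycleSpace := by
    ext z
    rw [LinearMap.mem_ker, mem_cycleSpace]
    simp only [← hinc]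
    exact funext_iff
  have hrange : inc.range ≠ ⊤ := by
    intro htop
    obtain ⟨v⟩ := ‹Nonempty V›
    obtain ⟨z, hz⟩ : Pi.single v 1 ∈ inc.range := htop ▸ Submodule.mem_top
    have h1 : ∑ w, inc z w = 0 := by
      simp only [hinc]
      rw [sum_comm]
      refine sum_eq_zero fun e _ => ?_
      rw [sum_add_distrib]
      simp [CharTwo.add_self_eq_zero]
    rw [hz, sum_pi_single'] at h1
    simp at h1
  have h1 := Submodule.finrank_lt hrange
  have h2 := inc.finrank_range_add_finrank_ker
  rw [hker, Module.finrank_fintype_fun_eq_card] at h2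
  rw [Module.finrank_fintype_fun_eq_card] at h1
  omega

theorem EdgeIn.exists_ne {z : G.edgeSet → ZMod 2} (hz : z ∈ G.cycleSpace) {u v : V}
    (h : EdgeIn z u v) : ∃ w, w ≠ v ∧ EdgeIn z u w := by
  by_contra! hno
  obtain ⟨he, hne⟩ := h
  have hzu := mem_cycleSpace.1 hz u
  have hadj : u ≠ v := G.ne_of_adj he
  rw [Fintype.sum_eq_single (⟨s(u, v), he⟩ : G.edgeSet)] at hzu
  · have hout : s((s(u, v) : Sym2 V).out.1, (s(u, v) : Sym2 V).out.2) = s(u, v) := Quot.out_eq _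
    rw [Sym2.eq_iff] at hout
    rcases hout with ⟨h1, h2⟩ | ⟨h1, h2⟩
    · simp only [h1, h2, hadj.symm, if_true, if_false, add_zero] at hzu
      exact hne hzu
    · simp only [h1, h2, hadj.symm, if_true, if_false, zero_add] at hzu
      exact hne hzu
  · intro f hf
    by_contra hfz
    have hfu : u ∈ f.1 ∧ z f ≠ 0 := by
      by_cases h1 : f.1.out.1 = u
      · refine ⟨h1 ▸ Sym2.out_fst_mem _, fun h0 => hfz (by simp [h0])⟩
      · by_cases h2 : f.1.out.2 = u
        · refine ⟨h2 ▸ Sym2.out_snd_mem _, fun h0 => hfz (by simp [h0])⟩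
        · exact absurd (by simp [h1, h2]) hfz
    obtain ⟨⟨w, hw⟩, hfz'⟩ := hfu
    obtain ⟨f, hfe⟩ := f
    simp only at hw
    subst hw
    by_cases hwv : w = v
    · subst hwv; exact hf rfl
    · exact hno w hwv ⟨hfe, hfz'⟩

/-- A nonzero element of the cycle space with fewer than four edges is a triangle. -/
theorem exists_isNClique_of_mem_cycleSpace {z : G.edgeSet → ZMod 2} (hz : z ∈ G.cycleSpace)
    (h0 : z ≠ 0) :
    3 ≤ #{e | z e ≠ 0} ∧ (#{e | z e ≠ 0} < 4 → ∃ t : Finset V, G.IsNClique 3 t ∧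
      ∀ e, z e ≠ 0 ↔ ∀ v ∈ e.1, v ∈ t) := by
  obtain ⟨⟨e, he⟩, hne⟩ := Function.ne_iff.1 h0
  set Z : Finset (Sym2 V) := ({e | z e ≠ 0} : Finset G.edgeSet).map (Function.Embedding.subtype _)
    with hZ
  have hcard : #Z = #{e | z e ≠ 0} := card_map _
  have hmemZ : ∀ {x y}, EdgeIn z x y → s(x, y) ∈ Z := fun {x y} ⟨h1, h2⟩ => by
    rw [hZ, mem_map]; exact ⟨⟨_, h1⟩, by simpa using h2, rfl⟩
  have hadj : ∀ {x y}, EdgeIn z x y → G.Adj x y := fun {x y} ⟨h1, h2⟩ => h1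
  rw [← hcard]
  induction e using Sym2.ind with
  | _ u v =>
    have huv : EdgeIn z u v := ⟨he, hne⟩
    obtain ⟨x, hxv, hux⟩ := huv.exists_ne hz
    obtain ⟨y, hyu, hvy⟩ := huv.symm.exists_ne hz
    have n1 := (hadj huv).ne
    have n2 := (hadj hux).ne
    have n3 := (hadj hvy).ne
    by_cases hxy : x = y
    · subst hxy
      have hsub : ({s(u, v), s(u, x), s(v, x)} : Finset (Sym2 V)) ⊆ Z := by
        intro e he
        simp only [mem_insert, mem_singleton] at he
        rcases he with rfl | rfl | rfl
        exacts [hmemZ huv, hmemZ hux, hmemZ hvy]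
      have h3 : #({s(u, v), s(u, x), s(v, x)} : Finset (Sym2 V)) = 3 := by
        rw [card_eq_three]
        refine ⟨_, _, _, ?_, ?_, ?_, rfl⟩ <;> rw [Ne, Sym2.eq_iff] <;> grind
      refine ⟨h3 ▸ card_le_card hsub, fun h4 => ⟨{u, v, x}, ?_, ?_⟩⟩
      · rw [SimpleGraph.is3Clique_iff]
        exact ⟨u, v, x, hadj huv, hadj hux, hadj hvy, rfl⟩
      · have hZeq : ({s(u, v), s(u, x), s(v, x)} : Finset (Sym2 V)) = Z :=
          eq_of_subset_of_card_le hsub (by omega)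
        rintro ⟨e, he⟩
        have : z ⟨e, he⟩ ≠ 0 ↔ e ∈ Z := by
          rw [hZ, mem_map]
          constructor
          · intro h; exact ⟨⟨e, he⟩, by simpa using h, rfl⟩
          · rintro ⟨f, hf, rfl⟩; exact (mem_filter.1 hf).2
        rw [this, ← hZeq]
        induction e using Sym2.ind with
        | _ p q =>
          have hpq : p ≠ q := G.ne_of_adj he
          simp only [mem_insert, mem_singleton, Sym2.eq_iff, Sym2.mem_iff]
          constructor
          · rintro h r hr; grind
          · intro h
            have h1 := h p (Or.inl rfl)
            have h2 := h q (Or.inr rfl)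
            grind
    · obtain ⟨w, hwu, hxw⟩ := hux.symm.exists_ne hz
      have n4 := (hadj hxw).ne
      have h4 : 4 ≤ #Z := by
        have hsub : ({s(u, v), s(u, x), s(v, y), s(x, w)} : Finset (Sym2 V)) ⊆ Z := by
          intro e he
          simp only [mem_insert, mem_singleton] at he
          rcases he with rfl | rfl | rfl | rfl
          exacts [hmemZ huv, hmemZ hux, hmemZ hvy, hmemZ hxw]
        refine le_trans (le_of_eq ?_) (card_le_card hsub)
        rw [card_insert_of_notMem, card_insert_of_notMem, card_insert_of_notMem, card_singleton]
        all_goals simp only [mem_insert, mem_singleton, Sym2.eq_iff]; grind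
      exact ⟨by omega, fun h => by omega⟩

/-- The counting form of Euler's formula: at least `e - n + 1` independent elements of the cycle
space cover each edge at most twice, and those with fewer than four edges are distinct triangles. -/
theorem PlaneEmbedding.two_mul_card_edgeSet_le [Fintype V] [Nonempty V] [DecidableRel G.Adj]
    (E : PlaneEmbedding G) :
    2 * Fintype.card G.edgeSet + 4 ≤ 4 * Fintype.card V + #(G.cliqueFinset 3) := by
  classical
  obtain ⟨T, hT⟩ := E.exists_isTwoSpanning
  obtain ⟨B, hBT, hcard, -, hind⟩ := Submodule.exists_finset_span_eq_linearIndepOn (ZMod 2)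
    (s := (T : Set (G.edgeSet → ZMod 2)))
  have hle : Module.finrank (ZMod 2) G.cycleSpace ≤ #B := by
    rw [hcard]; exact Submodule.finrank_mono hT.le_span
  have hdim := G.card_edgeSet_lt_add_finrank_cycleSpace
  have hBmem : ∀ z ∈ B, z ∈ G.cycleSpace := fun z hz => hT.mem z (by simpa using hBT hz)
  have hB0 : ∀ z ∈ B, z ≠ 0 := fun z hz h => by
    have := hind.ne_zero hz
    exact this h
  have hsum : ∑ z ∈ B, #{e | z e ≠ 0} ≤ 2 * Fintype.card G.edgeSet := by
    have : ∑ z ∈ B, #{e : G.edgeSet | z e ≠ 0} = ∑ e : G.edgeSet, #{z ∈ B | z e ≠ 0} := by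
      simp only [card_filter]
      rw [sum_comm]
    rw [this]
    refine (sum_le_card_nsmul _ _ 2 fun e _ => ?_).trans (by simp [mul_comm])
    refine (card_le_card ?_).trans (hT.card_le e)
    exact filter_subset_filter _ (by simpa using hBT)
  have hsmall : #{z ∈ B | #{e | z e ≠ 0} < 4} ≤ #(G.cliqueFinset 3) := by
    have : ∀ z : G.edgeSet → ZMod 2, ∃ t : Finset V, z ∈ B → #{e | z e ≠ 0} < 4 →
        G.IsNClique 3 t ∧ ∀ e, z e ≠ 0 ↔ ∀ v ∈ e.1, v ∈ t := by
      intro z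
      by_cases hz : z ∈ B
      · by_cases h4 : #{e | z e ≠ 0} < 4
        · obtain ⟨t, ht⟩ := (exists_isNClique_of_mem_cycleSpace (hBmem z hz) (hB0 z hz)).2 h4
          exact ⟨t, fun _ _ => ht⟩
        · exact ⟨∅, fun _ h => absurd h h4⟩
      · exact ⟨∅, fun h => absurd h hz⟩
    choose τ hτ using this
    refine card_le_card_of_injOn τ ?_ ?_
    · intro z hz
      have hz := mem_filter.1 hz
      simpa [SimpleGraph.mem_cliqueFinset_iff] using (hτ z hz.1 hz.2).1
    · intro z hz y hy hzy
      have hz := mem_filter.1 hz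
      have hy := mem_filter.1 hy
      funext e
      have h1 := (hτ z hz.1 hz.2).2 e
      have h2 := (hτ y hy.1 hy.2).2 e
      rw [hzy, ← h2] at h1
      have two : ∀ p q : ZMod 2, (p ≠ 0 ↔ q ≠ 0) → p = q := by decide
      exact two _ _ h1
  have h4 : 4 * #B ≤ ∑ z ∈ B, #{e | z e ≠ 0} + #{z ∈ B | #{e | z e ≠ 0} < 4} := by
    rw [card_filter, ← sum_add_distrib, mul_comm, ← smul_eq_mul]
    refine card_nsmul_le_sum _ _ _ fun z hz => ?_
    have := (exists_isNClique_of_mem_cycleSpace (hBmem z hz) (hB0 z hz)).1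
    split_ifs <;> omega
  omega

end Counting

/-! ### Light triangles in diamond-free plane graphs -/

/-- No edge lies in two triangles. -/
def SimpleGraph.NoDiamond {V : Type*} (G : SimpleGraph V) : Prop :=
  ∀ u v x y, G.Adj u v → G.Adj u x → G.Adj v x → G.Adj u y → G.Adj v y → x = y

theorem noDiamond_of_free {V : Type*} {G : SimpleGraph V} (h : diamondGraph.Free G) :
    G.NoDiamond := by
  intro u v x y huv hux hvx huy hvy
  by_contra hxy
  refine h ⟨⟨⟨![x, y, u, v], ?_⟩, ?_⟩⟩
  · intro i j hij
    simp only [diamondGraph, SimpleGraph.deleteEdges_adj, SimpleGraph.top_adj] at hij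
    obtain ⟨hne, hmem⟩ := hij
    fin_cases i <;> fin_cases j <;> simp at hne hmem ⊢ <;>
      first | assumption | (apply SimpleGraph.Adj.symm; assumption)
  · intro i j hij
    have := huv.ne
    have := hux.ne
    have := hvx.ne
    have := huy.ne
    have := hvy.ne
    fin_cases i <;> fin_cases j <;> simp at hij ⊢ <;> grind

namespace SimpleGraph

variable {V : Type*} [DecidableEq V] {G : SimpleGraph V}

theorem exists_eq_triple_of_mem {T : Finset V} (hT : G.IsNClique 3 T) {v x : V} (hv : v ∈ T)
    (hx : x ∈ T) (hvx : v ≠ x) :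
    ∃ y, T = {v, x, y} ∧ G.Adj v x ∧ G.Adj v y ∧ G.Adj x y := by
  obtain ⟨a, b, c, hab, hac, hbc, rfl⟩ := is3Clique_iff.1 hT
  have := hab.symm
  have := hac.symm
  have := hbc.symm
  simp only [mem_insert, mem_singleton] at hv hx
  rcases hv with rfl | rfl | rfl <;> rcases hx with rfl | rfl | rfl
  all_goals first
    | exact absurd rfl hvx
    | exact ⟨_, rfl, by assumption, by assumption, by assumption⟩
    | exact ⟨a, by grind, by assumption, by assumption, by assumption⟩
    | exact ⟨b, by grind, by assumption, by assumption, by assumption⟩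
    | exact ⟨c, by grind, by assumption, by assumption, by assumption⟩

theorem NoDiamond.clique_eq (hG : G.NoDiamond) {T T' : Finset V} (hT : G.IsNClique 3 T)
    (hT' : G.IsNClique 3 T') {v x : V} (hvx : v ≠ x) (hv : v ∈ T) (hx : x ∈ T) (hv' : v ∈ T')
    (hx' : x ∈ T') : T = T' := by
  obtain ⟨y, rfl, h1, h2, h3⟩ := exists_eq_triple_of_mem hT hv hx hvx
  obtain ⟨y', rfl, -, h2', h3'⟩ := exists_eq_triple_of_mem hT' hv' hx' hvx
  rw [hG v x y y' h1 h2 h3 h2' h3']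

variable [Fintype V] [DecidableRel G.Adj]

/-- The triangles at `v` give disjoint pairs of neighbors of `v`. -/
theorem NoDiamond.two_mul_card_triangles_le (hG : G.NoDiamond) (v : V) :
    2 * #{T ∈ G.cliqueFinset 3 | v ∈ T} ≤ G.degree v := by
  have hdisj : Set.PairwiseDisjoint (↑({T ∈ G.cliqueFinset 3 | v ∈ T} : Finset (Finset V)))
      (fun T : Finset V => T.erase v) := by
    intro T hT T' hT' hne
    simp only [coe_filter, mem_cliqueFinset_iff, Set.mem_ofPred_eq] at hT hT'
    refine Finset.disjoint_left.2 fun x hx hx' => ?_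
    exact hne (hG.clique_eq hT.1 hT'.1 (ne_of_mem_erase hx).symm hT.2 (mem_of_mem_erase hx)
      hT'.2 (mem_of_mem_erase hx'))
  have h1 : ∑ T ∈ G.cliqueFinset 3 with v ∈ T, #(T.erase v) =
      2 * #{T ∈ G.cliqueFinset 3 | v ∈ T} := by
    rw [sum_congr rfl (g := fun _ => 2), sum_const, smul_eq_mul, mul_comm]
    intro T hT
    rw [mem_filter, mem_cliqueFinset_iff] at hT
    rw [card_erase_of_mem hT.2, hT.1.card_eq]
  rw [← h1, ← card_biUnion hdisj, ← card_neighborFinset_eq_degree]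
  refine card_le_card fun x hx => ?_
  obtain ⟨T, hT, hx⟩ := mem_biUnion.1 hx
  rw [mem_filter, mem_cliqueFinset_iff] at hT
  rw [mem_neighborFinset]
  exact hT.1.isClique hT.2 (mem_of_mem_erase hx) (ne_of_mem_erase hx).symm

/-- Discharging: the charge `deg v - 4` of each vertex pays for the triangles at `v`. In units of
one half, this is what `v` gives to the triangle `T`. -/
def triangleShare (G : SimpleGraph V) [DecidableRel G.Adj] (v : V) (T : Finset V) : ℕ :=
  if G.degree v ≤ 4 then 0 else if 7 ≤ G.degree v then 2 else
    if G.degree v = 6 ∧ ∀ u ∈ T, u ≠ v → G.degree u ≤ 4 then 2 else 1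

/-- A diamond-free plane graph has a vertex of degree at most 3, or a triangle with degrees at most
4, 4, 5, or a vertex of degree at most 6 in two triangles all of whose other vertices have degree
at most 4. -/
theorem exists_light_configuration [Nonempty V] (hP : IsPlanar G) (hG : G.NoDiamond) :
    (∃ v, G.degree v ≤ 3) ∨
    (∃ v u w, G.Adj v u ∧ G.Adj v w ∧ G.Adj u w ∧ G.degree v ≤ 5 ∧ G.degree u ≤ 4 ∧
      G.degree w ≤ 4) ∨
    (∃ v u u' w w', G.Adj v u ∧ G.Adj v u' ∧ G.Adj u u' ∧ G.Adj v w ∧ G.Adj v w' ∧ G.Adj w w' ∧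
      u ≠ w ∧ u ≠ w' ∧ u' ≠ w ∧ u' ≠ w' ∧
      G.degree v ≤ 6 ∧ G.degree u ≤ 4 ∧ G.degree u' ≤ 4 ∧ G.degree w ≤ 4 ∧ G.degree w' ≤ 4) := by
  obtain ⟨E⟩ := hP
  have hcount := E.two_mul_card_edgeSet_le
  rw [← edgeFinset_card, ← sum_degrees_eq_twice_card_edges] at hcount
  by_contra! hno
  obtain ⟨h1, h2, h3⟩ := hno
  -- a vertex of degree at most 6 lies in at most one triangle whose other vertices are light
  have hsmall : ∀ v, #{T ∈ G.cliqueFinset 3 | v ∈ T ∧ ∀ u ∈ T, u ≠ v → G.degree u ≤ 4} ≤ 1 ∨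
      7 ≤ G.degree v := by
    intro v
    by_contra! hv
    obtain ⟨T, hT, T', hT', hne⟩ := one_lt_card.1 hv.1
    rw [mem_filter, mem_cliqueFinset_iff] at hT hT'
    obtain ⟨hT, hvT, hd⟩ := hT
    obtain ⟨hT', hvT', hd'⟩ := hT'
    have key : ∀ {T : Finset V}, G.IsNClique 3 T → v ∈ T → ∃ x y, T = {v, x, y} ∧
        G.Adj v x ∧ G.Adj v y ∧ G.Adj x y := by
      intro T hT hv
      obtain ⟨x, hx, hxv⟩ := exists_mem_ne (by rw [hT.card_eq]; norm_num) v
      obtain ⟨y, h⟩ := exists_eq_triple_of_mem hT hv hx hxv.symm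
      exact ⟨x, y, h⟩
    have hcap : ∀ x ∈ T, x ∈ T' → x = v := fun x hx hx' => by
      by_contra hxv
      exact hne (hG.clique_eq hT hT' (Ne.symm hxv) hvT hx hvT' hx')
    obtain ⟨u, u', rfl, a1, a2, a3⟩ := key hT hvT
    obtain ⟨w, w', rfl, b1, b2, b3⟩ := key hT' hvT'
    have := a1.ne
    have := a2.ne
    have := b1.ne
    have := b2.ne
    refine absurd (h3 v u u' w w' a1 a2 a3 b1 b2 b3 ?_ ?_ ?_ ?_ (by omega)
      (hd u (by simp) a1.ne') (hd u' (by simp) a2.ne') (hd' w (by simp) b1.ne'))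
      (not_lt.2 (hd' w' (by simp) b2.ne'))
    · rintro rfl; exact a1.ne' (hcap u (by simp) (by simp))
    · rintro rfl; exact a1.ne' (hcap u (by simp) (by simp))
    · rintro rfl; exact a2.ne' (hcap u' (by simp) (by simp))
    · rintro rfl; exact a2.ne' (hcap u' (by simp) (by simp))
  have hvert : ∀ v, ∑ T ∈ G.cliqueFinset 3 with v ∈ T, G.triangleShare v T + 8 ≤
      2 * G.degree v := by
    intro v
    have hk := hG.two_mul_card_triangles_le v
    have hlow := h1 v
    by_cases h7 : 7 ≤ G.degree v
    · have : ∑ T ∈ G.cliqueFinset 3 with v ∈ T, G.triangleShare v T ≤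
          #{T ∈ G.cliqueFinset 3 | v ∈ T} • 2 := by
        refine sum_le_card_nsmul _ _ _ fun T _ => ?_
        unfold triangleShare; split_ifs <;> omega
      rw [smul_eq_mul] at this
      omega
    · have hone := (hsmall v).resolve_right h7
      have hone : #{T ∈ {T ∈ G.cliqueFinset 3 | v ∈ T} | ∀ u ∈ T, u ≠ v → G.degree u ≤ 4} ≤ 1 := by
        rwa [filter_filter]
      by_cases h4 : G.degree v ≤ 4
      · have : ∑ T ∈ G.cliqueFinset 3 with v ∈ T, G.triangleShare v T = 0 := by
          refine sum_eq_zero fun T _ => ?_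
          simp [triangleShare, h4]
        omega
      · by_cases h6 : G.degree v = 6
        · have : ∑ T ∈ G.cliqueFinset 3 with v ∈ T, G.triangleShare v T ≤
              ∑ T ∈ G.cliqueFinset 3 with v ∈ T,
                (1 + if ∀ u ∈ T, u ≠ v → G.degree u ≤ 4 then 1 else 0) := by
            refine sum_le_sum fun T _ => ?_
            unfold triangleShare
            split_ifs <;> first | omega | tauto
          rw [sum_add_distrib, ← card_filter, sum_const, smul_eq_mul, mul_one] at this
          omega
        · have : ∑ T ∈ G.cliqueFinset 3 with v ∈ T, G.triangleShare v T ≤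
              #{T ∈ G.cliqueFinset 3 | v ∈ T} • 1 := by
            refine sum_le_card_nsmul _ _ _ fun T _ => ?_
            unfold triangleShare; split_ifs <;> omega
          rw [smul_eq_mul] at this
          omega
  have htri : ∀ T ∈ G.cliqueFinset 3, 2 ≤ ∑ v ∈ T, G.triangleShare v T := by
    intro T hT
    obtain ⟨x, y, z, hxy, hxz, hyz, rfl⟩ := is3Clique_iff.1 ((mem_cliqueFinset_iff).1 hT)
    rw [sum_insert (by simp [hxy.ne, hxz.ne]), sum_insert (by simp [hyz.ne]), sum_singleton]
    have e1 := h2 x y z hxy hxz hyz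
    have e2 := h2 y x z hxy.symm hyz hxz
    have e3 := h2 z x y hxz.symm hyz.symm hxy
    have hpos : ∀ v T, 5 ≤ G.degree v → 1 ≤ G.triangleShare v T := by
      intro v T hv
      unfold triangleShare
      split_ifs <;> omega
    have htwo : ∀ v T, 6 ≤ G.degree v → (∀ u ∈ T, u ≠ v → G.degree u ≤ 4) →
        2 ≤ G.triangleShare v T := by
      intro v T hv h
      unfold triangleShare
      split_ifs with c1 c2 c3
      · omega
      · omega
      · omega
      · exact absurd ⟨by omega, h⟩ c3
    by_cases cx : G.degree x ≤ 4 <;> by_cases cy : G.degree y ≤ 4 <;>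
      by_cases cz : G.degree z ≤ 4
    · have := e1 (by omega) cy; omega
    · have hz6 : 6 ≤ G.degree z := by
        by_contra hc; have := e3 (by omega) cx; omega
      have := htwo z {x, y, z} hz6 (by simp [cx, cy])
      omega
    · have hy6 : 6 ≤ G.degree y := by
        by_contra hc; have := e2 (by omega) cx; omega
      have := htwo y {x, y, z} hy6 (by simp [cx, cz])
      omega
    · have := hpos y {x, y, z} (by omega)
      have := hpos z {x, y, z} (by omega)
      omega
    · have hx6 : 6 ≤ G.degree x := by
        by_contra hc; have := e1 (by omega) cy; omega
      have := htwo x {x, y, z} hx6 (by simp [cy, cz])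
      omega
    · have := hpos x {x, y, z} (by omega)
      have := hpos z {x, y, z} (by omega)
      omega
    · have := hpos x {x, y, z} (by omega)
      have := hpos y {x, y, z} (by omega)
      omega
    · have := hpos x {x, y, z} (by omega)
      have := hpos y {x, y, z} (by omega)
      omega
  have hswap : ∑ v, ∑ T ∈ G.cliqueFinset 3 with v ∈ T, G.triangleShare v T =
      ∑ T ∈ G.cliqueFinset 3, ∑ v ∈ T, G.triangleShare v T := by
    simp only [sum_filter]
    rw [sum_comm]
    refine sum_congr rfl fun T _ => ?_
    simp
  have hlo := card_nsmul_le_sum _ _ _ htri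
  have hhi := sum_le_sum fun v (_ : v ∈ univ) => hvert v
  rw [sum_add_distrib, hswap, sum_const, ← mul_sum, card_univ, smul_eq_mul] at hhi
  rw [smul_eq_mul] at hlo
  omega

end SimpleGraph

/-! ### Reducible sets -/

section Flexibility

open Classical

variable {V C : Type*}

/-- The map `φ` is a proper coloring of the subgraph of `G` induced on `A`. -/
def ProperOn (G : SimpleGraph V) (A : Finset V) (φ : V → C) : Prop :=
  ∀ u ∈ A, ∀ v ∈ A, G.Adj u v → φ u ≠ φ v

theorem ProperOn.update {G : SimpleGraph V} {B : Finset V} {φ : V → C} (h : ProperOn G B φ)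
    {v : V} (hv : v ∉ B) {c : C} (hc : ∀ u ∈ B, G.Adj v u → φ u ≠ c) :
    ProperOn G (insert v B) (Function.update φ v c) := by
  intro x hx y hy hxy
  rw [mem_insert] at hx hy
  have hne := hxy.ne
  rcases hx with rfl | hx <;> rcases hy with rfl | hy
  · exact absurd rfl hne
  · rw [Function.update_self, Function.update_of_ne hne.symm]
    exact (hc y hy hxy).symm
  · rw [Function.update_self, Function.update_of_ne hne]
    exact hc x hx hxy.symm
  · rw [Function.update_of_ne (ne_of_mem_of_not_mem hx hv),
      Function.update_of_ne (ne_of_mem_of_not_mem hy hv)]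
    exact h x hx y hy hxy

/-- The vertices of `B' \ B` can be colored greedily from lists of size 5 after those of `B`, even
if one color is forbidden at the vertices of `I`. -/
inductive GreedyExtends (G : SimpleGraph V) (I : Finset V) : Finset V → Finset V → Prop
  | refl (B : Finset V) : GreedyExtends G I B B
  | step {B B' : Finset V} {v : V} : v ∉ B →
      #{u ∈ B | G.Adj v u} + (if v ∈ I then 1 else 0) < 5 →
      GreedyExtends G I (insert v B) B' → GreedyExtends G I B B'

/-- A set `H` of at most five vertices of `A`, each with at most three neighbors in `A \ H`, such
that each list coloring on `A \ H` extends to `A`, both with a prescribed admissible color at one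
vertex of `H`, and with one color forbidden on an independent subset of `H`. The set of neighbors
in `H` of a vertex outside `A` has to be independent. -/
structure IsReducible (G : SimpleGraph V) (A H : Finset V) : Prop where
  nonempty : H.Nonempty
  subset : H ⊆ A
  card_le : #H ≤ 5
  card_outer_le : ∀ v ∈ H, #{u ∈ A \ H | G.Adj v u} ≤ 3
  prescribe : ∀ v ∈ H, GreedyExtends G ∅ (A \ H.erase v) A
  forbid : ∀ I ⊆ H, (∀ u ∈ I, ∀ v ∈ I, ¬ G.Adj u v) → GreedyExtends G I (A \ H) A
  independent : ∀ x ∉ A, ∀ u ∈ H, ∀ v ∈ H, G.Adj x u → G.Adj x v → ¬ G.Adj u v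

theorem GreedyExtends.subset {G : SimpleGraph V} {I B B' : Finset V}
    (h : GreedyExtends G I B B') : B ⊆ B' := by
  induction h with
  | refl => exact subset_refl _
  | step _ _ _ ih => exact (subset_insert _ _).trans ih

/-! ### Random list colorings -/

variable [Fintype V]

/-- The maps that take the color of each vertex from its list. -/
noncomputable def listMaps (L : V → Finset C) : Finset (V → C) := Fintype.piFinset L

/-- A probability distribution on the list colorings of the subgraph of `G` induced on `A`. The
colors outside `A` are arbitrary elements of the lists. -/
structure IsColoringDistribution (G : SimpleGraph V) (L : V → Finset C) (A : Finset V)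
    (μ : (V → C) → ℝ) : Prop where
  nonneg : ∀ φ, 0 ≤ μ φ
  sum_eq : ∑ φ ∈ listMaps L, μ φ = 1
  proper : ∀ φ ∈ listMaps L, μ φ ≠ 0 → ProperOn G A φ

/-- The probability of the event `E`. -/
noncomputable def eventProb (L : V → Finset C) (μ : (V → C) → ℝ) (E : (V → C) → Prop) : ℝ :=
  ∑ φ ∈ listMaps L with E φ, μ φ

/-- The list colorings on `A` that agree with `φ` outside `H`. -/
noncomputable def extensions (G : SimpleGraph V) (L : V → Finset C) (A H : Finset V) (φ : V → C) :
    Finset (V → C) :=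
  {ψ ∈ listMaps L | (∀ v ∉ H, ψ v = φ v) ∧ ProperOn G A ψ}

theorem card_extensions_le (G : SimpleGraph V) {L : V → Finset C} {k : ℕ}
    (hL : ∀ v, #(L v) = k) (A H : Finset V) (φ : V → C) :
    #(extensions G L A H φ) ≤ k ^ #H := by
  have hsub : extensions G L A H φ ⊆ Fintype.piFinset fun v => if v ∈ H then L v else {φ v} := by
    intro ψ hψ
    obtain ⟨h1, h2, -⟩ := mem_filter.1 hψ
    rw [Fintype.mem_piFinset]
    intro v
    split_ifs with hv
    · exact Fintype.mem_piFinset.1 h1 v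
    · simp [h2 v hv]
  refine (card_le_card hsub).trans ?_
  rw [Fintype.card_piFinset]
  have : ∀ v, #(if v ∈ H then L v else {φ v}) = if v ∈ H then k else 1 := by
    intro v; split_ifs <;> simp [hL]
  simp only [this]
  rw [prod_ite]
  simp

/-- A random list coloring on `A \ H` is extended to `A` by choosing uniformly among the at most
`k ^ #H` extensions. -/
theorem IsColoringDistribution.exists_extension {G : SimpleGraph V} {L : V → Finset C} {k : ℕ}
    (hL : ∀ v, #(L v) = k) {A H : Finset V} {μ : (V → C) → ℝ}
    (hμ : IsColoringDistribution G L (A \ H) μ)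
    (hext : ∀ φ ∈ listMaps L, ProperOn G (A \ H) φ → (extensions G L A H φ).Nonempty) :
    ∃ ν, IsColoringDistribution G L A ν ∧
      (∀ E' E : (V → C) → Prop,
        (∀ φ ∈ listMaps L, ProperOn G (A \ H) φ → E' φ → ∃ ψ ∈ extensions G L A H φ, E ψ) →
        (1 / (k : ℝ) ^ #H) * eventProb L μ E' ≤ eventProb L ν E) ∧
      (∀ E' E : (V → C) → Prop,
        (∀ φ, E' φ → ∀ ψ ∈ extensions G L A H φ, E ψ) →
        eventProb L μ E' ≤ eventProb L ν E) := by
  set ext := extensions G L A H with hextdef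
  let ν : (V → C) → ℝ := fun ψ => ∑ φ ∈ listMaps L, if ψ ∈ ext φ then μ φ / #(ext φ) else 0
  have hprob : ∀ E, eventProb L ν E =
      ∑ φ ∈ listMaps L, μ φ / #(ext φ) * #{ψ ∈ ext φ | E ψ} := by
    intro E
    simp only [eventProb, ν]
    rw [sum_comm]
    refine sum_congr rfl fun φ _ => ?_
    rw [← sum_filter, sum_const, nsmul_eq_mul, mul_comm]
    congr 3
    ext ψ
    simp only [mem_filter, hextdef, extensions]
    tauto
  have hle : ∀ (E' : (V → C) → Prop) (r : (V → C) → ℝ), (∀ φ, 0 ≤ r φ) → ∀ t : ℝ, 0 ≤ t →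
      (∀ φ ∈ listMaps L, ProperOn G (A \ H) φ → E' φ → t ≤ r φ) →
      t * eventProb L μ E' ≤ ∑ φ ∈ listMaps L, μ φ * r φ := by
    intro E' r hr t ht h
    rw [eventProb, mul_sum, sum_filter]
    refine sum_le_sum fun φ hφ => ?_
    split_ifs with hE
    · by_cases h0 : μ φ = 0
      · simp [h0]
      · rw [mul_comm]
        exact mul_le_mul_of_nonneg_left (h φ hφ (hμ.proper φ hφ h0) hE) (hμ.nonneg φ)
    · exact mul_nonneg (hμ.nonneg φ) (hr φ)
  have hfull : ∀ E' E : (V → C) → Prop, (∀ φ, E' φ → ∀ ψ ∈ ext φ, E ψ) →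
        eventProb L μ E' ≤ eventProb L ν E := by
    intro E' E h
    rw [hprob]
    have := hle E' (fun φ => #{ψ ∈ ext φ | E ψ} / #(ext φ)) (fun φ => by positivity) 1
      zero_le_one (by
        intro φ hφ hp hE
        rw [filter_true_of_mem (h φ hE), div_self]
        have := (hext φ hφ hp).card_pos
        positivity)
    rw [one_mul] at this
    refine this.trans (le_of_eq (sum_congr rfl fun φ _ => by ring))
  refine ⟨ν, ⟨?_, ?_, ?_⟩, ?_, hfull⟩
  · intro ψ
    refine sum_nonneg fun φ _ => ?_
    split_ifs
    · exact div_nonneg (hμ.nonneg φ) (by positivity)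
    · rfl
  · have h1 := hprob fun _ => True
    simp only [eventProb, filter_true] at h1
    rw [h1, ← hμ.sum_eq]
    refine sum_congr rfl fun φ hφ => ?_
    by_cases h0 : μ φ = 0
    · simp [h0]
    · have := (hext φ hφ (hμ.proper φ hφ h0)).card_pos
      field_simp
  · intro ψ hψ h0
    obtain ⟨φ, hφ, hne⟩ := exists_ne_zero_of_sum_ne_zero h0
    have : ψ ∈ ext φ := by
      by_contra hc
      simp [hc] at hne
    exact (mem_filter.1 this).2.2
  · intro E' E h
    rw [hprob]
    refine (hle E' (fun φ => #{ψ ∈ ext φ | E ψ} / #(ext φ)) (fun φ => by positivity)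
      (1 / (k : ℝ) ^ #H) (by positivity) ?_).trans
        (le_of_eq (sum_congr rfl fun φ _ => by ring))
    intro φ hφ hp hE
    obtain ⟨ψ, hψ, hEψ⟩ := h φ hφ hp hE
    have h1 : 1 ≤ #{ψ ∈ ext φ | E ψ} := card_pos.2 ⟨ψ, mem_filter.2 ⟨hψ, hEψ⟩⟩
    have h2 : 0 < #(ext φ) := card_pos.2 ⟨ψ, hψ⟩
    have h3 : #(ext φ) ≤ k ^ #H := card_extensions_le G hL A H φ
    have h3' : (#(ext φ) : ℝ) ≤ (k : ℝ) ^ #H := by exact_mod_cast h3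
    have h1' : (1 : ℝ) ≤ #{ψ ∈ ext φ | E ψ} := by exact_mod_cast h1
    have h2' : (0 : ℝ) < #(ext φ) := by exact_mod_cast h2
    exact div_le_div₀ (by positivity) h1' h2' h3'

/-! ### Extending colorings to reducible sets -/

theorem update_mem_listMaps {L : V → Finset C} {φ : V → C} (hφ : φ ∈ listMaps L) {v : V} {c : C}
    (hc : c ∈ L v) : Function.update φ v c ∈ listMaps L := by
  refine Fintype.mem_piFinset.2 fun u => ?_
  by_cases hu : u = v
  · subst hu; simpa using hc
  · rw [Function.update_of_ne hu]; exact Fintype.mem_piFinset.1 hφ u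

theorem GreedyExtends.exists_coloring {G : SimpleGraph V} {L : V → Finset C}
    (hL : ∀ v, #(L v) = 5) {I : Finset V} (c : C) {B B' : Finset V} (h : GreedyExtends G I B B') :
    ∀ {φ : V → C}, φ ∈ listMaps L → ProperOn G B φ →
    ∃ ψ ∈ listMaps L, ProperOn G B' ψ ∧ (∀ u, u ∈ B ∨ u ∉ B' → ψ u = φ u) ∧
      ∀ u ∈ B', u ∉ B → u ∈ I → ψ u ≠ c := by
  induction h with
  | refl B => intro φ hφ hp; exact ⟨φ, hφ, hp, by simp, fun u h1 h2 => absurd h1 h2⟩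
  | @step B B' v hv hcard hl ih =>
    intro φ hφ hp
    have hlt : #(image φ {u ∈ B | G.Adj v u} ∪ if v ∈ I then {c} else ∅) < #(L v) := by
      rw [hL]
      refine lt_of_le_of_lt ((card_union_le _ _).trans (add_le_add card_image_le ?_)) hcard
      split_ifs <;> simp
    obtain ⟨d, hd, hdn⟩ := exists_mem_notMem_of_card_lt_card hlt
    rw [mem_union, not_or] at hdn
    obtain ⟨ψ, h1, h2, h3, h4⟩ := ih (update_mem_listMaps hφ hd) (hp.update hv (by
      intro u hu huv he
      exact hdn.1 (mem_image.2 ⟨u, mem_filter.2 ⟨hu, huv⟩, he⟩)))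
    refine ⟨ψ, h1, h2, ?_, ?_⟩
    · intro u hu
      have huv : u ≠ v := by
        rintro rfl
        exact hu.elim hv fun hu => hu (hl.subset (mem_insert_self _ _))
      rw [h3 u (hu.imp_left mem_insert_of_mem), Function.update_of_ne huv]
    · intro u hu huB huI
      by_cases huv : u = v
      · subst huv
        rw [h3 u (Or.inl (mem_insert_self _ _)), Function.update_self]
        intro hdc
        exact hdn.2 (by simp [huI, hdc])
      · exact h4 u hu (by simp [huv, huB]) huI

section Reducible

variable {G : SimpleGraph V} {A H : Finset V} (h : IsReducible G A H) {L : V → Finset C}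
  (hL : ∀ v, #(L v) = 5)
include h hL

theorem IsReducible.exists_extension_forbid {φ : V → C} (hφ : φ ∈ listMaps L)
    (hp : ProperOn G (A \ H) φ) {I : Finset V} (hI : I ⊆ H)
    (hind : ∀ u ∈ I, ∀ v ∈ I, ¬ G.Adj u v) (c : C) :
    ∃ ψ ∈ extensions G L A H φ, ∀ u ∈ I, ψ u ≠ c := by
  obtain ⟨ψ, h1, h2, h3, h4⟩ := (h.forbid I hI hind).exists_coloring hL c hφ hp
  refine ⟨ψ, mem_filter.2 ⟨h1, fun v hv => h3 v ?_, h2⟩,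
    fun u hu => h4 u (h.subset (hI hu)) (by simp [hI hu]) hu⟩
  by_cases hvA : v ∈ A <;> simp [hv, hvA]

theorem IsReducible.exists_extension_prescribe {φ : V → C} (hφ : φ ∈ listMaps L)
    (hp : ProperOn G (A \ H) φ) {v : V} (hv : v ∈ H) {c : C} (hc : c ∈ L v)
    (hfree : ∀ u ∈ A \ H, G.Adj v u → φ u ≠ c) :
    ∃ ψ ∈ extensions G L A H φ, ψ v = c := by
  have hp' := hp.update (v := v) (by simp [hv]) hfree
  rw [← sdiff_erase (h.subset hv)] at hp'
  obtain ⟨ψ, h1, h2, h3, -⟩ := (h.prescribe v hv).exists_coloring hL c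
    (update_mem_listMaps hφ hc) hp'
  refine ⟨ψ, mem_filter.2 ⟨h1, fun u hu => ?_, h2⟩, ?_⟩
  · have huv : u ≠ v := fun e => hu (e ▸ hv)
    rw [h3 u (by by_cases huA : u ∈ A <;> simp [hu, huA]), Function.update_of_ne huv]
  · rw [h3 v (Or.inl (by simp [h.subset hv])), Function.update_self]

end Reducible

/-- If every nonempty set of vertices contains a reducible set, then there is a random list
coloring in which each vertex has each color of its list with probability bounded below. The
induction also needs that it avoids a given color, with probability bounded below, on each set of
at most three common neighbors of one vertex already removed. -/
theorem exists_isColoringDistribution {G : SimpleGraph V} {L : V → Finset C}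
    (hL : ∀ v, #(L v) = 5) (hred : ∀ A : Finset V, A.Nonempty → ∃ H, IsReducible G A H)
    (A : Finset V) :
    ∃ μ, IsColoringDistribution G L A μ ∧
      (∀ v ∈ A, ∀ c ∈ L v, (1 / 5 ^ 5 : ℝ) ^ 4 ≤ eventProb L μ (fun φ => φ v = c)) ∧
      (∀ x ∉ A, ∀ I ⊆ A, (∀ u ∈ I, G.Adj x u) → #I ≤ 3 → ∀ c,
        (1 / 5 ^ 5 : ℝ) ^ #I ≤ eventProb L μ (fun φ => ∀ u ∈ I, φ u ≠ c)) := by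
  induction A using Finset.strongInduction with
  | H A ih =>
    rcases A.eq_empty_or_nonempty with rfl | hA
    · have hne : (listMaps L).Nonempty := by
        refine Fintype.piFinset_nonempty.2 fun v => card_pos.1 (by rw [hL]; norm_num)
      have hsum : ∑ φ ∈ listMaps L, (1 / #(listMaps L) : ℝ) = 1 := by
        rw [sum_const, nsmul_eq_mul]
        have := hne.card_pos
        field_simp
      refine ⟨fun _ => 1 / #(listMaps L), ⟨fun _ => by positivity, hsum, ?_⟩, by simp, ?_⟩
      · intro φ _ _ u hu; simp at hu
      · intro x _ I hI _ _ c
        obtain rfl := subset_empty.1 hI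
        simp only [eventProb, notMem_empty, false_implies, implies_true, filter_true, card_empty,
          pow_zero]
        exact hsum.ge
    · obtain ⟨H, hH⟩ := hred A hA
      obtain ⟨μ, hμ, hμ1, hμ2⟩ := ih (A \ H) (sdiff_ssubset hH.subset hH.nonempty)
      obtain ⟨ν, hν, hν1, hν2⟩ := hμ.exists_extension hL (by
        intro φ hφ hp
        have hLne : ∃ c : C, True := by
          obtain ⟨v, -⟩ := hA
          obtain ⟨c, -⟩ := card_pos.1 (show 0 < #(L v) by rw [hL]; norm_num)
          exact ⟨c, trivial⟩
        obtain ⟨c, -⟩ := hLne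
        obtain ⟨ψ, hψ, -⟩ := hH.exists_extension_forbid hL hφ hp (empty_subset _) (by simp) c
        exact ⟨ψ, hψ⟩)
      have hstep : ∀ E' E : (V → C) → Prop,
          (∀ φ ∈ listMaps L, ProperOn G (A \ H) φ → E' φ → ∃ ψ ∈ extensions G L A H φ, E ψ) →
          (1 / 5 ^ 5 : ℝ) * eventProb L μ E' ≤ eventProb L ν E := by
        intro E' E hE
        refine le_trans (mul_le_mul_of_nonneg_right ?_ ?_) (hν1 E' E hE)
        · push_cast
          exact one_div_le_one_div_of_le (by positivity)
            (pow_le_pow_right₀ (by norm_num) hH.card_le)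
        · exact sum_nonneg fun φ _ => hμ.nonneg φ
      refine ⟨ν, hν, ?_, ?_⟩
      · intro v hv c hc
        by_cases hvH : v ∈ H
        · -- with positive probability no neighbor of `v` outside `H` has color `c`
          have h1 := hμ2 v (by simp [hvH]) {u ∈ A \ H | G.Adj v u} (filter_subset _ _)
            (by simp) (hH.card_outer_le v hvH) c
          have h2 := hstep (fun φ => ∀ u ∈ ({u ∈ A \ H | G.Adj v u} : Finset V), φ u ≠ c)
            (fun φ => φ v = c) (by
              intro φ hφ hp hE
              refine hH.exists_extension_prescribe hL hφ hp hvH hc fun u hu huv => ?_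
              exact hE u (mem_filter.2 ⟨hu, huv⟩))
          have h3 : (1 / 5 ^ 5 : ℝ) ^ 3 ≤ (1 / 5 ^ 5 : ℝ) ^ #{u ∈ A \ H | G.Adj v u} :=
            pow_le_pow_of_le_one (by positivity) (by norm_num) (hH.card_outer_le v hvH)
          calc (1 / 5 ^ 5 : ℝ) ^ 4 = (1 / 5 ^ 5 : ℝ) * (1 / 5 ^ 5 : ℝ) ^ 3 := by ring
            _ ≤ _ := mul_le_mul_of_nonneg_left (h3.trans h1) (by positivity)
            _ ≤ _ := h2
        · refine (hμ1 v (by simp [hv, hvH]) c hc).trans (hν2 _ _ ?_)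
          intro φ hE ψ hψ
          rw [(mem_filter.1 hψ).2.1 v hvH]
          exact hE
      · intro x hx I hI hxI hcard c
        by_cases hemp : I ∩ H = ∅
        · have hIH : ∀ u ∈ I, u ∉ H := fun u hu hu' => by
            have : u ∈ I ∩ H := mem_inter.2 ⟨hu, hu'⟩
            simp [hemp] at this
          refine (hμ2 x (by simp [hx]) I ?_ hxI hcard c).trans (hν2 _ _ ?_)
          · intro u hu; exact mem_sdiff.2 ⟨hI hu, hIH u hu⟩
          · intro φ hE ψ hψ u hu
            rw [(mem_filter.1 hψ).2.1 u (hIH u hu)]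
            exact hE u hu
        · have hlt : #(I \ H) + 1 ≤ #I := by
            have := card_inter_add_card_sdiff I H
            have := card_pos.2 (nonempty_iff_ne_empty.2 hemp)
            omega
          have h1 := hμ2 x (by simp [hx]) (I \ H) (sdiff_subset_sdiff hI (subset_refl H))
            (fun u hu => hxI u (mem_sdiff.1 hu).1) (by omega) c
          have h2 := hstep (fun φ => ∀ u ∈ I \ H, φ u ≠ c) (fun φ => ∀ u ∈ I, φ u ≠ c) (by
            intro φ hφ hp hE
            obtain ⟨ψ, hψ, hψc⟩ := hH.exists_extension_forbid hL hφ hp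
              (I := I ∩ H) inter_subset_right (by
                intro u hu v hv
                rw [mem_inter] at hu hv
                exact hH.independent x hx u hu.2 v hv.2 (hxI u hu.1) (hxI v hv.1)) c
            refine ⟨ψ, hψ, fun u hu => ?_⟩
            by_cases huH : u ∈ H
            · exact hψc u (mem_inter.2 ⟨hu, huH⟩)
            · rw [(mem_filter.1 hψ).2.1 u huH]
              exact hE u (mem_sdiff.2 ⟨hu, huH⟩))
          calc (1 / 5 ^ 5 : ℝ) ^ #I ≤ (1 / 5 ^ 5 : ℝ) ^ (#(I \ H) + 1) :=
                pow_le_pow_of_le_one (by positivity) (by norm_num) hlt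
            _ = (1 / 5 ^ 5 : ℝ) * (1 / 5 ^ 5 : ℝ) ^ #(I \ H) := by ring
            _ ≤ _ := mul_le_mul_of_nonneg_left h1 (by positivity)
            _ ≤ _ := h2

/-- A random coloring that takes each color with probability at least `ε` collects at least
the fraction `ε` of the total weight on average, hence for some outcome. -/
theorem isWeightedFlexible_of_isColoringDistribution {G : SimpleGraph V} {L : V → Finset C}
    {ε : ℝ} {μ : (V → C) → ℝ} (hμ : IsColoringDistribution G L univ μ)
    (hε : ∀ v, ∀ c ∈ L v, ε ≤ eventProb L μ (fun φ => φ v = c)) : IsWeightedFlexible G L ε := by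
  intro w hw
  set W := ε * ∑ v, ∑ c ∈ L v, w v c with hW
  have hmean : W ≤ ∑ φ ∈ listMaps L, μ φ * ∑ v, w v (φ v) := by
    have h1 : ∀ v, ∑ φ ∈ listMaps L, μ φ * w v (φ v) =
        ∑ c ∈ L v, w v c * eventProb L μ (fun φ => φ v = c) := by
      intro v
      have hmaps : ∀ φ ∈ listMaps L, φ v ∈ L v := fun φ hφ => Fintype.mem_piFinset.1 hφ v
      rw [← sum_fiberwise_of_maps_to hmaps]
      refine sum_congr rfl fun c _ => ?_
      rw [eventProb, mul_sum]
      refine sum_congr rfl fun φ hφ => ?_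
      rw [(mem_filter.1 hφ).2, mul_comm]
    simp only [mul_sum]
    rw [sum_comm, hW, mul_sum]
    refine sum_le_sum fun v _ => ?_
    rw [h1, mul_sum]
    refine sum_le_sum fun c hc => ?_
    rw [mul_comm]
    exact mul_le_mul_of_nonneg_left (hε v c hc) (hw v c hc)
  have hex : ∃ φ ∈ listMaps L, μ φ ≠ 0 ∧ W ≤ ∑ v, w v (φ v) := by
    by_contra! hno
    have h1 : ∑ φ ∈ listMaps L, μ φ * W = W := by rw [← sum_mul, hμ.sum_eq, one_mul]
    obtain ⟨φ, hφ, hφ0⟩ := exists_ne_zero_of_sum_ne_zero (show ∑ φ ∈ listMaps L, μ φ ≠ 0 by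
      rw [hμ.sum_eq]; exact one_ne_zero)
    have h2 : ∑ φ ∈ listMaps L, μ φ * ∑ v, w v (φ v) < ∑ φ ∈ listMaps L, μ φ * W := by
      refine sum_lt_sum (fun φ hφ => ?_) ⟨φ, hφ, ?_⟩
      · by_cases h0 : μ φ = 0
        · simp [h0]
        · exact mul_le_mul_of_nonneg_left (hno φ hφ h0).le (hμ.nonneg φ)
      · exact mul_lt_mul_of_pos_left (hno φ hφ hφ0) (lt_of_le_of_ne (hμ.nonneg φ) hφ0.symm)
    linarith
  obtain ⟨φ, hφ, hφ0, hle⟩ := hex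
  have hproper := hμ.proper φ hφ hφ0
  exact ⟨SimpleGraph.Coloring.mk φ fun {u v} huv => hproper u (mem_univ _) v (mem_univ _) huv,
    fun v => Fintype.mem_piFinset.1 hφ v, hle⟩

end Flexibility

/-! ### The light configurations are reducible -/

section Reducible

open Classical

variable {V : Type*} {G : SimpleGraph V}

theorem card_adj_add_card_le {A B D : Finset V} (hBA : B ⊆ A) (hDA : D ⊆ A) (hBD : Disjoint B D)
    {u : V} (hD : ∀ d ∈ D, G.Adj u d) :
    #{w ∈ B | G.Adj u w} + #D ≤ #{w ∈ A | G.Adj u w} := by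
  rw [← card_union_of_disjoint (disjoint_of_subset_left (filter_subset _ _) hBD)]
  refine card_le_card (union_subset (filter_subset_filter _ hBA) fun d hd => ?_)
  exact mem_filter.2 ⟨hDA hd, hD d hd⟩

theorem card_adj_le {A B : Finset V} (hBA : B ⊆ A) {u : V} :
    #{w ∈ B | G.Adj u w} ≤ #{w ∈ A | G.Adj u w} :=
  card_le_card (filter_subset_filter _ hBA)

/-- The next vertex to be colored is `v`, where `insert v S` is the set of uncolored vertices. -/
theorem GreedyExtends.cons {I A S : Finset V} {v : V} (hv : v ∈ A) (hvS : v ∉ S)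
    (hcard : #{u ∈ A \ insert v S | G.Adj v u} + (if v ∈ I then 1 else 0) < 5)
    (h : GreedyExtends G I (A \ S) A) : GreedyExtends G I (A \ insert v S) A := by
  refine GreedyExtends.step (v := v) (by simp) hcard ?_
  have : insert v (A \ insert v S) = A \ S := by
    ext x
    by_cases hx : x = v
    · subst hx; simp [hv, hvS]
    · simp [hx]
  rwa [this]

/-- Two adjacent vertices of degree at most 4 can be colored, if the forbidden color is forbidden
at only one of them: that one is colored first. -/
theorem GreedyExtends.cons_pair {I A S : Finset V} {p q : V} (hp : p ∈ A) (hq : q ∈ A)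
    (hpS : p ∉ S) (hqS : q ∉ S) (hpq : G.Adj p q) (hp4 : #{x ∈ A | G.Adj p x} ≤ 4)
    (hq4 : #{x ∈ A | G.Adj q x} ≤ 4) (hI : ¬ (p ∈ I ∧ q ∈ I))
    (h : GreedyExtends G I (A \ S) A) : GreedyExtends G I (A \ insert p (insert q S)) A := by
  have key : ∀ p q : V, p ∈ A → q ∈ A → p ∉ S → q ∉ S → G.Adj p q → #{x ∈ A | G.Adj p x} ≤ 4 →
      #{x ∈ A | G.Adj q x} ≤ 4 → q ∉ I → GreedyExtends G I (A \ insert p (insert q S)) A := by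
    intro p q hp hq hpS hqS hpq hp4 hq4 hqI
    refine GreedyExtends.cons hp (by simp [hpq.ne, hpS]) ?_
      (GreedyExtends.cons hq hqS ?_ h)
    · have := card_adj_add_card_le (G := G) (u := p) (A := A) (D := {q})
        (B := A \ insert p (insert q S)) sdiff_subset (by simpa) (by simp) (by simpa)
      rw [card_singleton] at this
      split_ifs <;> omega
    · have := card_adj_le (G := G) (u := q) (A := A) (B := A \ insert q S) sdiff_subset
      rw [if_neg hqI]
      omega
  by_cases hqI : q ∈ I
  · rw [insert_comm]
    exact key q p hq hp hqS hpS hpq.symm hq4 hp4 fun hpI => hI ⟨hpI, hqI⟩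
  · exact key p q hp hq hpS hqS hpq hp4 hq4 hqI

theorem isReducible_singleton {A : Finset V} {v : V} (hv : v ∈ A)
    (hd : #{w ∈ A | G.Adj v w} ≤ 3) : IsReducible G A {v} where
  nonempty := singleton_nonempty v
  subset := by simpa
  card_le := by simp
  card_outer_le := by
    intro u hu
    rw [mem_singleton] at hu
    subst hu
    exact (card_adj_le sdiff_subset).trans hd
  prescribe := by
    intro u hu
    rw [mem_singleton] at hu
    subst hu
    rw [erase_singleton, sdiff_empty]
    exact .refl A
  forbid := by
    intro I _ _
    refine GreedyExtends.cons (S := ∅) hv (by simp) ?_ (by rw [sdiff_empty]; exact .refl A)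
    have := card_adj_le (G := G) (u := v) (sdiff_subset (s := A) (t := insert v ∅))
    split_ifs <;> omega
  independent := by
    intro x _ u hu w hw _ _
    rw [mem_singleton] at hu hw
    subst hu hw
    exact G.irrefl

theorem SimpleGraph.NoDiamond.not_adj_and_adj (hG : G.NoDiamond) {u v w x : V} (huv : G.Adj u v)
    (huw : G.Adj u w) (hvw : G.Adj v w) (hxw : x ≠ w) : ¬ (G.Adj x u ∧ G.Adj x v) :=
  fun h => hxw (hG u v x w huv h.1.symm h.2.symm huw hvw)

/-- In a triangle `v u w` with degrees at most 5, 4, 4, color `v` first. -/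
theorem isReducible_triangle (hG : G.NoDiamond) {A : Finset V} {v u w : V} (hvA : v ∈ A)
    (huA : u ∈ A) (hwA : w ∈ A) (hvu : G.Adj v u) (hvw : G.Adj v w) (huw : G.Adj u w)
    (hv : #{x ∈ A | G.Adj v x} ≤ 5) (hu : #{x ∈ A | G.Adj u x} ≤ 4)
    (hw : #{x ∈ A | G.Adj w x} ≤ 4) : IsReducible G A {v, u, w} := by
  have n1 := hvu.ne
  have n2 := hvw.ne
  have n3 := huw.ne
  have base : ∀ I, GreedyExtends G I (A \ ∅) A := fun I => by rw [sdiff_empty]; exact .refl A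
  have pair : ∀ I, ¬ (u ∈ I ∧ w ∈ I) → GreedyExtends G I (A \ {u, w}) A := fun I hI =>
    .cons_pair (S := ∅) huA hwA (by simp) (by simp) huw hu hw hI (base I)
  have hvB : #{x ∈ A \ {v, u, w} | G.Adj v x} ≤ 3 := by
    have := card_adj_add_card_le (G := G) (u := v) (A := A) (B := A \ {v, u, w}) (D := {u, w})
      sdiff_subset (by simp [insert_subset_iff, huA, hwA]) (by rw [Finset.disjoint_right]; simp)
      (by simp [hvu, hvw])
    rw [card_pair n3] at this
    omega
  have houter : ∀ p q : V, q ∈ A → q ∈ ({v, u, w} : Finset V) → G.Adj p q →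
      #{x ∈ A | G.Adj p x} ≤ 4 → #{x ∈ A \ {v, u, w} | G.Adj p x} ≤ 3 := by
    intro p q hq hq' hpq hp
    have := card_adj_add_card_le (G := G) (u := p) (A := A) (B := A \ {v, u, w}) (D := {q})
      sdiff_subset (by simpa) (by rw [disjoint_singleton_right]; simp [hq']) (by simpa)
    rw [card_singleton] at this
    omega
  -- when `u` or `w` has been colored already, `v` still has the other one as uncolored neighbor
  have rest : ∀ q : V, q ∈ A → G.Adj v q → #{x ∈ A | G.Adj q x} ≤ 4 →
      GreedyExtends G ∅ (A \ {v, q}) A := by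
    intro q hq hvq hq4
    refine .cons (S := {q}) hvA (by simp [hvq.ne]) ?_ (.cons (S := ∅) hq (by simp) ?_ (base ∅))
    · have := card_adj_add_card_le (G := G) (u := v) (A := A) (B := A \ {v, q}) (D := {q})
        sdiff_subset (by simpa) (by simp) (by simpa)
      rw [card_singleton] at this
      rw [if_neg (notMem_empty _)]
      omega
    · have := card_adj_le (G := G) (u := q) (A := A) (B := A \ insert q ∅) sdiff_subset
      rw [if_neg (notMem_empty _)]
      omega
  have e1 : ({v, u, w} : Finset V).erase v = {u, w} := erase_insert (by simp [n1, n2])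
  have e2 : ({v, u, w} : Finset V).erase u = {v, w} := by
    rw [insert_comm, erase_insert (by simp [n1.symm, n3])]
  have e3 : ({v, u, w} : Finset V).erase w = {v, u} := by
    rw [pair_comm u w, insert_comm, erase_insert (by simp [n2.symm, n3.symm])]
  refine ⟨by simp, by simp [insert_subset_iff, hvA, huA, hwA], card_le_three.trans (by norm_num),
    ?_, ?_, ?_, ?_⟩
  · intro x hx
    simp only [mem_insert, mem_singleton] at hx
    rcases hx with rfl | rfl | rfl
    · exact hvB
    · exact houter x w hwA (by simp) huw hu
    · exact houter x u huA (by simp) huw.symm hw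
  · intro x hx
    simp only [mem_insert, mem_singleton] at hx
    rcases hx with rfl | rfl | rfl
    · rw [e1]; exact pair ∅ (by simp)
    · rw [e2]; exact rest w hwA hvw hw
    · rw [e3]; exact rest u huA hvu hu
  · intro I hI hind
    refine .cons hvA (by simp [n1, n2]) (by split_ifs <;> omega)
      (pair I fun h => hind u h.1 w h.2 huw)
  · intro x hx a ha b hb hxa hxb hab
    have y1 := hG.not_adj_and_adj hvu hvw huw (ne_of_mem_of_not_mem hwA hx).symm
    have y2 := hG.not_adj_and_adj hvw hvu huw.symm (ne_of_mem_of_not_mem huA hx).symm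
    have y3 := hG.not_adj_and_adj huw hvu.symm hvw.symm (ne_of_mem_of_not_mem hvA hx).symm
    simp only [mem_insert, mem_singleton] at ha hb
    rcases ha with rfl | rfl | rfl <;> rcases hb with rfl | rfl | rfl <;>
      first
      | exact hab.ne rfl
      | exact y1 ⟨by assumption, by assumption⟩
      | exact y2 ⟨by assumption, by assumption⟩
      | exact y3 ⟨by assumption, by assumption⟩

/-- For two triangles `v u u'` and `v w w'`, color `v` first, and then each of the pairs `u, u'` and
`w, w'`. -/
theorem isReducible_bowtie (hG : G.NoDiamond) {A : Finset V} {v u u' w w' : V} (hvA : v ∈ A)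
    (huA : u ∈ A) (huA' : u' ∈ A) (hwA : w ∈ A) (hwA' : w' ∈ A) (hvu : G.Adj v u)
    (hvu' : G.Adj v u') (huu : G.Adj u u') (hvw : G.Adj v w) (hvw' : G.Adj v w')
    (hww : G.Adj w w') (h1 : u ≠ w) (h2 : u ≠ w') (h3 : u' ≠ w) (h4 : u' ≠ w')
    (hv : #{x ∈ A | G.Adj v x} ≤ 6) (hu : #{x ∈ A | G.Adj u x} ≤ 4)
    (hu' : #{x ∈ A | G.Adj u' x} ≤ 4) (hw : #{x ∈ A | G.Adj w x} ≤ 4)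
    (hw' : #{x ∈ A | G.Adj w' x} ≤ 4) : IsReducible G A {v, u, u', w, w'} := by
  have n1 := hvu.ne
  have n2 := hvu'.ne
  have n3 := hvw.ne
  have n4 := hvw'.ne
  have n5 := huu.ne
  have n6 := hww.ne
  have base : ∀ I, GreedyExtends G I (A \ ∅) A := fun I => by rw [sdiff_empty]; exact .refl A
  have pairs : ∀ I, ¬ (u ∈ I ∧ u' ∈ I) → ¬ (w ∈ I ∧ w' ∈ I) →
      GreedyExtends G I (A \ {u, u', w, w'}) A := fun I hI hI' =>
    .cons_pair huA huA' (by simp [h1, h2]) (by simp [h3, h4]) huu hu hu' hI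
      (.cons_pair (S := ∅) hwA hwA' (by simp) (by simp) hww hw hw' hI' (base I))
  have hvB : #{x ∈ A \ {v, u, u', w, w'} | G.Adj v x} ≤ 2 := by
    have := card_adj_add_card_le (G := G) (u := v) (A := A) (B := A \ {v, u, u', w, w'})
      (D := {u, u', w, w'}) sdiff_subset (by simp [insert_subset_iff, huA, huA', hwA, hwA'])
      (by rw [Finset.disjoint_right]; simp) (by simp [hvu, hvu', hvw, hvw'])
    have h4 : #({u, u', w, w'} : Finset V) = 4 := by
      rw [card_insert_of_notMem (by simp [n5, h1, h2]), card_insert_of_notMem (by simp [h3, h4]),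
        card_pair n6]
    omega
  have houter : ∀ p q : V, q ∈ A → q ∈ ({v, u, u', w, w'} : Finset V) → G.Adj p q →
      #{x ∈ A | G.Adj p x} ≤ 4 → #{x ∈ A \ {v, u, u', w, w'} | G.Adj p x} ≤ 3 := by
    intro p q hq hq' hpq hp
    have := card_adj_add_card_le (G := G) (u := p) (A := A) (B := A \ {v, u, u', w, w'}) (D := {q})
      sdiff_subset (by simpa) 
      (by rw [disjoint_singleton_right]; exact fun h => (mem_sdiff.1 h).2 hq') (by simpa)
    rw [card_singleton] at this
    omega
  -- when the partner of `p` has been colored already, `v` still has uncolored neighbors `q`, `q'`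
  have rest : ∀ p q q' : V, p ∈ A → q ∈ A → q' ∈ A → v ≠ p → v ≠ q → v ≠ q' → p ≠ q → p ≠ q' →
      q ≠ q' → G.Adj v q → G.Adj v q' → G.Adj q q' → #{x ∈ A | G.Adj p x} ≤ 4 →
      #{x ∈ A | G.Adj q x} ≤ 4 → #{x ∈ A | G.Adj q' x} ≤ 4 →
      GreedyExtends G ∅ (A \ {v, p, q, q'}) A := by
    intro p q q' hp hq hq' m1 m2 m3 m4 m5 m6 hvq hvq' hqq k1 k2 k3
    refine .cons hvA (by simp [m1, m2, m3]) ?_ (.cons hp (by simp [m4, m5]) ?_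
      (.cons_pair (S := ∅) hq hq' (by simp) (by simp) hqq k2 k3 (by simp) (base ∅)))
    · have := card_adj_add_card_le (G := G) (u := v) (A := A) (B := A \ {v, p, q, q'})
        (D := {q, q'}) sdiff_subset (by simp [insert_subset_iff, hq, hq'])
        (by rw [Finset.disjoint_right]; simp) (by simp [hvq, hvq'])
      rw [card_pair m6] at this
      rw [if_neg (notMem_empty _)]
      omega
    · have := card_adj_le (G := G) (u := p) (A := A) (B := A \ {p, q, q'}) sdiff_subset
      rw [if_neg (notMem_empty _)]
      omega
  have e1 : ({v, u, u', w, w'} : Finset V).erase v = {u, u', w, w'} :=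
    erase_insert (by simp [n1, n2, n3, n4])
  have e2 : ({v, u, u', w, w'} : Finset V).erase u = {v, u', w, w'} := by
    rw [insert_comm, erase_insert (by simp [n1.symm, n5, h1, h2])]
  have e3 : ({v, u, u', w, w'} : Finset V).erase u' = {v, u, w, w'} := by
    rw [insert_comm u u', insert_comm, erase_insert (by simp [n2.symm, n5.symm, h3, h4])]
  have hcomm : ({v, u, u', w, w'} : Finset V) = {v, w, w', u, u'} := by
    rw [insert_comm u' w, insert_comm u w, pair_comm u' w', insert_comm u w']
  have e4 : ({v, u, u', w, w'} : Finset V).erase w = {v, w', u, u'} := by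
    rw [hcomm, insert_comm, erase_insert (by simp [n3.symm, n6, h1.symm, h3.symm])]
  have e5 : ({v, u, u', w, w'} : Finset V).erase w' = {v, w, u, u'} := by
    rw [hcomm, insert_comm w w', insert_comm,
      erase_insert (by simp [n4.symm, n6.symm, h2.symm, h4.symm])]
  refine ⟨by simp, by simp [insert_subset_iff, hvA, huA, huA', hwA, hwA'], card_le_five,
    ?_, ?_, ?_, ?_⟩
  · intro x hx
    simp only [mem_insert, mem_singleton] at hx
    rcases hx with rfl | rfl | rfl | rfl | rfl
    · omega
    · exact houter x u' huA' (by simp) huu hu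
    · exact houter x u huA (by simp) huu.symm hu'
    · exact houter x w' hwA' (by simp) hww hw
    · exact houter x w hwA (by simp) hww.symm hw'
  · intro x hx
    simp only [mem_insert, mem_singleton] at hx
    rcases hx with rfl | rfl | rfl | rfl | rfl
    · rw [e1]; exact pairs ∅ (by simp) (by simp)
    · rw [e2]; exact rest u' w w' huA' hwA hwA' n2 n3 n4 h3 h4 n6 hvw hvw' hww hu' hw hw'
    · rw [e3]; exact rest u w w' huA hwA hwA' n1 n3 n4 h1 h2 n6 hvw hvw' hww hu hw hw'
    · rw [e4]
      exact rest w' u u' hwA' huA huA' n4 n1 n2 h2.symm h4.symm n5 hvu hvu' huu hw' hu hu'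
    · rw [e5]
      exact rest w u u' hwA huA huA' n3 n1 n2 h1.symm h3.symm n5 hvu hvu' huu hw hu hu'
  · intro I hI hind
    exact .cons hvA (by simp [n1, n2, n3, n4]) (by split_ifs <;> omega)
      (pairs I (fun h => hind u h.1 u' h.2 huu) fun h => hind w h.1 w' h.2 hww)
  · intro x hx a ha b hb hxa hxb hab
    have y1 := hG.not_adj_and_adj hvu hvu' huu (ne_of_mem_of_not_mem huA' hx).symm
    have y2 := hG.not_adj_and_adj hvu' hvu huu.symm (ne_of_mem_of_not_mem huA hx).symm
    have y3 := hG.not_adj_and_adj huu hvu.symm hvu'.symm (ne_of_mem_of_not_mem hvA hx).symm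
    have z1 := hG.not_adj_and_adj hvw hvw' hww (ne_of_mem_of_not_mem hwA' hx).symm
    have z2 := hG.not_adj_and_adj hvw' hvw hww.symm (ne_of_mem_of_not_mem hwA hx).symm
    have z3 := hG.not_adj_and_adj hww hvw.symm hvw'.symm (ne_of_mem_of_not_mem hvA hx).symm
    -- an edge between the two pairs would form a diamond with `v`
    have c1 : ¬ G.Adj u w := fun h => h3 (hG v u u' w hvu hvu' huu hvw h)
    have c2 : ¬ G.Adj u w' := fun h => h4 (hG v u u' w' hvu hvu' huu hvw' h)
    have c3 : ¬ G.Adj u' w := fun h => h1 (hG v u' u w hvu' hvu huu.symm hvw h)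
    have c4 : ¬ G.Adj u' w' := fun h => h2 (hG v u' u w' hvu' hvu huu.symm hvw' h)
    simp only [mem_insert, mem_singleton] at ha hb
    rcases ha with rfl | rfl | rfl | rfl | rfl <;> rcases hb with rfl | rfl | rfl | rfl | rfl <;>
      first
      | exact hab.ne rfl
      | exact c1 hab
      | exact c2 hab
      | exact c3 hab
      | exact c4 hab
      | exact c1 hab.symm
      | exact c2 hab.symm
      | exact c3 hab.symm
      | exact c4 hab.symm
      | exact y1 ⟨by assumption, by assumption⟩
      | exact y2 ⟨by assumption, by assumption⟩
      | exact y3 ⟨by assumption, by assumption⟩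
      | exact z1 ⟨by assumption, by assumption⟩
      | exact z2 ⟨by assumption, by assumption⟩
      | exact z3 ⟨by assumption, by assumption⟩

end Reducible

/-! ### Reducible sets in all induced subgraphs -/

theorem IsPlanar.induce {V : Type*} {G : SimpleGraph V} (h : IsPlanar G) (s : Set V) :
    IsPlanar (G.induce s) := by
  obtain ⟨E⟩ := h
  have hedge : ∀ e ∈ (G.induce s).edgeSet, e.map Subtype.val ∈ G.edgeSet := by
    intro e
    induction e using Sym2.ind with
    | _ x y => exact fun he => he
  refine ⟨⟨fun x => E.pos x, fun e => E.arc (e.map Subtype.val), ?_, ?_, ?_, ?_⟩⟩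
  · exact E.pos_injective.comp Subtype.val_injective
  · intro x y hxy
    exact E.isPolygonalArc x y hxy
  · intro e he x hx
    obtain ⟨y, hy, hyx⟩ := Sym2.mem_map.1 (E.mem_of_pos_mem _ (hedge e he) _ hx)
    rwa [← Subtype.ext hyx]
  · intro e he f hf hef x hxe hxf
    obtain ⟨v, hve, hvf, rfl⟩ := E.arc_inter _ (hedge e he) _ (hedge f hf)
      (fun h => hef (Sym2.map.injective Subtype.val_injective h)) x hxe hxf
    obtain ⟨y, hy, rfl⟩ := Sym2.mem_map.1 hve
    obtain ⟨z, hz, hzy⟩ := Sym2.mem_map.1 hvf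
    exact ⟨y, hy, by rwa [← Subtype.ext hzy], rfl⟩

open Classical in
theorem degree_induce_eq {V : Type*} (G : SimpleGraph V) (A : Finset V) (v : (A : Set V)) :
    (G.induce (A : Set V)).degree v = #{w ∈ A | G.Adj v w} := by
  rw [← SimpleGraph.card_neighborFinset_eq_degree, ← card_map (Function.Embedding.subtype _)]
  congr 1
  ext w
  simp only [mem_map, SimpleGraph.mem_neighborFinset, mem_filter, Function.Embedding.coe_subtype]
  constructor
  · rintro ⟨x, hx, rfl⟩
    exact ⟨x.2, hx⟩
  · rintro ⟨hw, hvw⟩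
    exact ⟨⟨w, hw⟩, hvw, rfl⟩

open Classical in
theorem exists_isReducible {V : Type*} {G : SimpleGraph V} (hP : IsPlanar G) (hG : G.NoDiamond)
    {A : Finset V} (hA : A.Nonempty) : ∃ H, IsReducible G A H := by
  have : Nonempty (A : Set V) := hA.to_subtype
  have hG' : (G.induce (A : Set V)).NoDiamond := fun u v x y h1 h2 h3 h4 h5 =>
    Subtype.ext (hG u v x y h1 h2 h3 h4 h5)
  rcases SimpleGraph.exists_light_configuration (hP.induce (A : Set V)) hG' with
    ⟨v, hv⟩ | ⟨v, u, w, a1, a2, a3, hv, hu, hw⟩ |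
    ⟨v, u, u', w, w', a1, a2, a3, a4, a5, a6, n1, n2, n3, n4, hv, hu, hu', hw, hw'⟩
  · rw [degree_induce_eq] at hv
    exact ⟨_, isReducible_singleton v.2 hv⟩
  · rw [degree_induce_eq] at hv hu hw
    exact ⟨_, isReducible_triangle hG v.2 u.2 w.2 a1 a2 a3 hv hu hw⟩
  · rw [degree_induce_eq] at hv hu hu' hw hw'
    exact ⟨_, isReducible_bowtie hG v.2 u.2 u'.2 w.2 w'.2 a1 a2 a3 a4 a5 a6
      (fun h => n1 (Subtype.ext h)) (fun h => n2 (Subtype.ext h)) (fun h => n3 (Subtype.ext h))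
      (fun h => n4 (Subtype.ext h)) hv hu hu' hw hw'⟩

theorem theorem1p3 :
    ∃ ε : ℝ, 0 < ε ∧
      ∀ (V : Type u) [Fintype V] (G : SimpleGraph V),
        IsPlanar G → diamondGraph.Free G →
          IsWeightedFlexibleForListsOfSize.{u, v} G ε 5 := by
  refine ⟨(1 / 5 ^ 5) ^ 4, by positivity, fun V _ G hP hF C L hL => ?_⟩
  obtain ⟨μ, hμ, hμL, -⟩ := exists_isColoringDistribution hL
    (fun A hA => exists_isReducible hP (noDiamond_of_free hF) hA) univ
  exact isWeightedFlexible_of_isColoringDistribution hμ fun v => hμL v (mem_univ v)
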